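/- A \emph{Fibonacci word} is a finite word $w$ in the letters $1,2$; its weight $|w|$ is the sum of its letters, and $\mathbb{YF}_n$ is the set of Fibonacci words of weight $n$. The relation $v\nearrow w$ is defined recursively by: $w=1v$, or $w=2u$ with $u\nearrow v$. Let $\dim(w)$ be the number of saturated chains $\varnothing=w_0\nearrow w_1\nearrow\dots\nearrow w_n=w$. For sequences $\vec x=(x_1,x_2,\ldots)$, $\vec y=(y_1,y_2,\ldots)$ let $A_\ell(\vec x\mid\vec y)$ be the $\ell\times\ell$ tridiagonal determinant with diagonal $x_1,x_2,\dots$, superdiagonal $y_1,y_2,\dots$ and subdiagonal $1,1,\dots$, and let $B_\ell(\vec x\mid\vec y)$ be the $(\ell+1)\times(\ell+1)$ tridiagonal determinant with diagonal $y_1,x_3,x_4,\dots$, superdiagonal $x_1y_2,y_3,y_4,\dots$ and subdiagonal $1,1,\dots$. The clone Schur functions are given by $s_{1^k}=A_k(\vec x\mid\vec y)$ and $s_{1^k2u}=B_k(\vec x+|u|\mid\vec y+|u|)\,s_u$, where $\vec x+r=(x_{1+r},x_{2+r},\ldots)$. Set $$M_n(w)=\dim(w)\,\frac{s_w(\vec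 x\mid\vec y)}{x_1\cdots x_n},\qquad w\in\mathbb{YF}_n .$$ Write $w=2^{h_1}12^{h_2}1\cdots12^{h_m}$ with $h_j\ge0$, and set $\tilde h_j=2h_j+1$ for $j<m$, $\tilde h_m=2h_m$, and $\tilde h_j=0$ for $j>m$. Let $\sigma\ge1$, $y_k=k+\sigma-1$ for $k\ge1$, $x_k=k+\sigma-1$ for $k\ge2$, and $x_1\in\{1,\sigma\}$ (either version of the shifted Plancherel specialization). Let $G(\alpha)=1-(1-\alpha)^{\sigma/2}$, $\alpha\in[0,1]$, be the distribution function of $\mathrm{beta}(1,\sigma/2)$. \textbf{Theorem.} All $M_n(w)$ are nonnegative and $M_n$ is a probability measure on $\mathbb{YF}_n$, $n\ge0$. There is a sequence $\xi_{\sigma;1},\xi_{\sigma;2},\ldots$ of $[0,1]$-valued random variables, unique in distribution, such that for all $n\ge1$ and $\alpha_1,\dots,\alpha_n\in[0,1]$ $$\mathbb P(\xi_{\sigma;1}\le\alpha_1,\ldots,\xi_{\sigma;n}\le\alpha_n)=\sigma^{-n+1}G(\alpha_1)\cdots G(\alpha_n)+(\sigma-1)\sum_{j=1}^{n-1}\sigma^{-n+j}G(\alpha_1)\cdots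 G(\alpha_{n-j}).$$ For $w$ distributed according to $M_n$ and each fixed $k$, one has, jointly in $j=1,\dots,k$ (with $0/0:=0$), $$\frac{\tilde h_j(w)}{n-\sum_{i<j}\tilde h_i(w)}\xrightarrow[n\to\infty]{d}\xi_{\sigma;j},\qquad\text{and also}\qquad \frac{\tilde h_j(w)}{n}\xrightarrow[n\to\infty]{d}\xi_{\sigma;j}\prod_{i<j}(1-\xi_{\sigma;i}).$$ The sequence $(\xi_{\sigma;j})$ can be constructed as follows: toss independent coins with success probabilities $1,\sigma^{-1},\sigma^{-1},\sigma^{-1},\ldots$, let $N\in\{1,2,\ldots\}\cup\{\infty\}$ be the number of successes before the first failure, take independent $\mathrm{beta}(1,\sigma/2)$ random variables $U_1,U_2,\ldots$, independent of the coins, and set $\xi_{\sigma;j}=U_j$ for $j\le N$ and $\xi_{\sigma;j}=0$ for $j>N$. For $\sigma>1$ the variables $\xi_{\sigma;1},\xi_{\sigma;2},\ldots$ are not independent. For $\sigma=1$ they are i.i.d. $\mathrm{beta}(1,1/2)$, so that for each fixed $k$ the vector $(\tilde h_1/n,\ldots,\tilde h_k/n)$ converges in distribution to the first $k$ coordinates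 of a $\mathrm{GEM}(1/2)$ sequence $X_j=U_j\prod_{i<j}(1-U_i)$, where $U_1,U_2,\ldots$ are i.i.d. $\mathrm{beta}(1,1/2)$. -/

import Mathlib

open MeasureTheory ProbabilityTheory Filter

namespace YoungFib

/-! ### The Young--Fibonacci lattice -/

/-- The two letters of Fibonacci words. -/
inductive Letter : Type
  | one : Letter
  | two : Letter

/-- A Fibonacci word is a finite word in the letters `1` and `2`, read from left to right. -/
abbrev Word : Type := List Letter

/-- The numerical value of a letter. -/
def Letter.val : Letter → ℕ
  | .one => 1
  | .two => 2

/-- The weight `|w|` of a word: the sum of its letters. -/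
def weight (w : Word) : ℕ := (w.map Letter.val).sum

/-- The set `YF n` of Fibonacci words of weight `n`. -/
def YF (n : ℕ) : Type := {w : Word // weight w = n}

/-- Every subset of the (finite) set `YF n` is measurable. -/
instance (n : ℕ) : MeasurableSpace (YF n) := ⊤

/-- The covering relation `v ↗ w` of the Young--Fibonacci lattice: either `w = 1v`, or
`w = 2u` with `u ↗ v`. -/
inductive Covers : Word → Word → Prop
  | one (v : Word) : Covers v (Letter.one :: v)
  | two {u v : Word} : Covers u v → Covers v (Letter.two :: u)

/-- `dim w` is the number of saturated chains `∅ = w₀ ↗ w₁ ↗ ⋯ ↗ wₙ = w`. -/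
noncomputable def dim (w : Word) : ℕ :=
  {c : List Word | c.IsChain Covers ∧ c.head? = some [] ∧ c.getLast? = some w}.ncard

/-! ### Clone Schur functions and clone coherent measures

Parameter sequences `x = (x₁, x₂, …)` are functions on `ℕ` whose value at `0` is never used. -/

/-- The shifted sequence `x + r = (x_{1+r}, x_{2+r}, …)`. -/
def shift (x : ℕ → ℝ) (r : ℕ) : ℕ → ℝ := fun k => x (k + r)

/-- The `l × l` tridiagonal determinant `A_l(x | y)`, with diagonal `x₁, x₂, …`, superdiagonal
`y₁, y₂, …` and subdiagonal `1, 1, …`. -/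
noncomputable def detA (x y : ℕ → ℝ) (l : ℕ) : ℝ :=
  Matrix.det (Matrix.of fun i j : Fin l =>
    if i.val = j.val then x (i.val + 1)
    else if j.val = i.val + 1 then y (i.val + 1)
    else if i.val = j.val + 1 then 1
    else 0)

/-- The `(k+1) × (k+1)` tridiagonal determinant `B_k(x | y)`, with first row
`y₁, x₁ y₂, 0, …`, second row `1, x₃, y₃, 0, …`, third row `0, 1, x₄, y₄, 0, …`, and so on. -/
noncomputable def detB (x y : ℕ → ℝ) (k : ℕ) : ℝ :=
  Matrix.det (Matrix.of fun i j : Fin (k + 1) =>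
    if i.val = 0 then
      (if j.val = 0 then y 1 else if j.val = 1 then x 1 * y 2 else 0)
    else if i.val = j.val then x (i.val + 2)
    else if j.val = i.val + 1 then y (i.val + 2)
    else if i.val = j.val + 1 then 1
    else 0)

/-- `cloneSchurAux x y k w` is the clone Schur function of the word `1ᵏ w`. -/
noncomputable def cloneSchurAux (x y : ℕ → ℝ) : ℕ → Word → ℝ
  | k, [] => detA x y k
  | k, Letter.one :: w => cloneSchurAux x y (k + 1) w
  | k, Letter.two :: u =>
      detB (shift x (weight u)) (shift y (weight u)) k * cloneSchurAux x y 0 u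

/-- The (biserial) clone Schur function `s_w(x | y)`: it equals `A_k(x | y)` for `w = 1ᵏ`, and
`B_k(x + |u| | y + |u|) s_u(x | y)` for `w = 1ᵏ2u`. -/
noncomputable def cloneSchur (x y : ℕ → ℝ) (w : Word) : ℝ := cloneSchurAux x y 0 w

/-- The weight `M_n(w) = dim(w) s_w(x | y) / (x₁ ⋯ x_n)`, `n = |w|`. -/
noncomputable def cloneWeight (x y : ℕ → ℝ) (w : Word) : ℝ :=
  dim w * (cloneSchur x y w / ∏ i ∈ Finset.Icc 1 (weight w), x i)

/-- The clone coherent measure `M_n` on `YF n`. -/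
noncomputable def cloneMeasure (x y : ℕ → ℝ) (n : ℕ) : Measure (YF n) :=
  Measure.sum fun w : YF n => ENNReal.ofReal (cloneWeight x y w.1) • Measure.dirac w

/-- The `x`-parameters of the shifted Plancherel specializations: `x_k = k + σ - 1` for `k ≥ 2`,
with a first parameter `x₁` (which will be `1` or `σ`). -/
noncomputable def plancherelX (σ x₁ : ℝ) : ℕ → ℝ := fun k => if k = 1 then x₁ else k + σ - 1

/-- The `y`-parameters of the shifted Plancherel specializations: `y_k = k + σ - 1`. -/
noncomputable def plancherelY (σ : ℝ) : ℕ → ℝ := fun k => k + σ - 1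

/-! ### Hikes -/

/-- The list `(h₁, …, h_m)` of hikes of `w = 2^{h₁} 1 2^{h₂} 1 ⋯ 1 2^{h_m}`. -/
def hikes : Word → List ℕ
  | [] => [0]
  | Letter.one :: w => 0 :: hikes w
  | Letter.two :: w => (hikes w).modifyHead (· + 1)

/-- The block weights, with indices starting from `0`: `hTilde w j` is `h̃_{j+1}`, where
`h̃_k = 2 h_k + 1` for `k < m`, `h̃_m = 2 h_m`, and `h̃_k = 0` for `k > m`. -/
def hTilde (w : Word) (j : ℕ) : ℕ :=
  if j + 1 < (hikes w).length then 2 * (hikes w).getD j 0 + 1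
  else if j + 1 = (hikes w).length then 2 * (hikes w).getD j 0
  else 0

/-- The vector of the first `k` normalized hikes `h̃_j / (n - h̃_1 - ⋯ - h̃_{j-1})`. -/
noncomputable def normalizedHikes (k n : ℕ) (w : YF n) : Fin k → ℝ := fun j =>
  (hTilde w.1 j : ℝ) / ((n : ℝ) - ∑ i ∈ Finset.range j, (hTilde w.1 i : ℝ))

/-- The vector `(h̃_1 / n, …, h̃_k / n)`. -/
noncomputable def scaledHikes (k n : ℕ) (w : YF n) : Fin k → ℝ := fun j =>
  (hTilde w.1 j : ℝ) / (n : ℝ)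

/-! ### The limiting random variables (indices start from `0`) -/

/-- The cumulative distribution function of `beta(1, σ/2)` on `[0,1]`. -/
noncomputable def betaCDF (σ α : ℝ) : ℝ := 1 - (1 - α) ^ (σ / 2)

/-- The joint cumulative distribution function `F_n(α₁, …, α_n)`, for `n ≥ 1`:
`σ^{-n+1} G(α₁) ⋯ G(α_n) + (σ - 1) ∑_{j=1}^{n-1} σ^{-n+j} G(α₁) ⋯ G(α_{n-j})`. -/
noncomputable def xiCDF (σ : ℝ) (n : ℕ) (α : ℕ → ℝ) : ℝ :=
  (σ⁻¹) ^ (n - 1) * ∏ i ∈ Finset.range n, betaCDF σ (α i) +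
    (σ - 1) * ∑ j ∈ Finset.Icc 1 (n - 1),
      (σ⁻¹) ^ (n - j) * ∏ i ∈ Finset.range (n - j), betaCDF σ (α i)

/-- `ξ 0, ξ 1, …` are random variables with values in `[0,1]` and with joint cumulative
distribution functions `xiCDF σ n`, `n ≥ 1`. -/
structure IsXiSequence (σ : ℝ) {Ω : Type*} [MeasurableSpace Ω] (P : Measure Ω)
    (ξ : ℕ → Ω → ℝ) : Prop where
  measurable : ∀ k, Measurable (ξ k)
  mem_Icc : ∀ k, ∀ᵐ ω ∂P, ξ k ω ∈ Set.Icc (0 : ℝ) 1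
  cdf : ∀ n : ℕ, 1 ≤ n → ∀ α : ℕ → ℝ, (∀ i < n, α i ∈ Set.Icc (0 : ℝ) 1) →
    P.real {ω | ∀ i < n, ξ i ω ≤ α i} = xiCDF σ n α

/-- `U 0, U 1, …` are independent `beta(1, b)` random variables. -/
structure IsIIDBeta (b : ℝ) {Ω : Type*} [MeasurableSpace Ω] (P : Measure Ω)
    (U : ℕ → Ω → ℝ) : Prop where
  measurable : ∀ k, Measurable (U k)
  law : ∀ k, P.map (U k) = betaMeasure 1 b
  indep : iIndepFun U P

/-- `c 0, c 1, …` are independent coins (`true` is a success) with success probabilities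
`1, σ⁻¹, σ⁻¹, σ⁻¹, …`. -/
structure IsCoinSequence (σ : ℝ) {Ω : Type*} [MeasurableSpace Ω] (P : Measure Ω)
    (c : ℕ → Ω → Bool) : Prop where
  measurable : ∀ k, Measurable (c k)
  prob_zero : P.real {ω | c 0 ω = true} = 1
  prob_succ : ∀ k, P.real {ω | c (k + 1) ω = true} = σ⁻¹
  indep : iIndepFun c P

/-- The number (possibly infinite) of successes before the first failure. -/
noncomputable def successes (c : ℕ → Bool) : ℕ∞ := ⨅ (j : ℕ) (_ : c j = false), (j : ℕ∞)

/-- The sequence whose first `N` terms are those of `U`, and whose further terms are zero. -/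
noncomputable def truncateAt (N : ℕ∞) (U : ℕ → ℝ) (k : ℕ) : ℝ :=
  open Classical in if (k : ℕ∞) < N then U k else 0

/-- Stick-breaking: `X₁ = U₁`, `X_k = (1 - U₁) ⋯ (1 - U_{k-1}) U_k`. -/
noncomputable def stickBreaking (U : ℕ → ℝ) (k : ℕ) : ℝ :=
  (∏ i ∈ Finset.range k, (1 - U i)) * U k

end YoungFib

open YoungFib

/-! The measures `M_n` obey a renewal-type recursion, and the limit theorem is the scaling limit of
that recursion.

For these parameters `x_{k+1} = y_k + 1`, so consecutive tridiagonal determinants have explicit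
differences. Hence `s_{1v} = s_v` for every `v` except one word `e_n` of each weight `n ≥ 2`, where
`(σ - 1) x₁⋯x_n` is added: `e_n = 1ⁿ` if `x₁ = σ`, and `e_n = 1ⁿ⁻²2` if `x₁ = 1`
(`exists_exceptional_words`). Together with `s_{2u} = (|u| + σ) s_u` and `dim(2u) = (|u| + 1) dim
u`, this describes a random word of weight `n + 3` (`wordMean_add_three`): it is `2` followed by a
random word of weight `n + 1` with probability `(n+2)/(n+2+σ)`, it is `1` followed by a random word
of weight `n + 2` with probability `1/(n+2+σ)`, and it is `e_{n+3}` with probability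
`(σ-1)/(n+2+σ)`. In particular the total mass is 1.

The first block survives beyond `αn` with probability a product of factors `m/(m+σ)`, where `m`
decreases in steps of two from about `n` to about `(1-α)n`. This product tends to `(1-α)^{σ/2}`
(`tendsto_blockMean_one`). When the block ends, what follows is a fresh random word with conditional
probability `σ⁻¹`; otherwise it is an exceptional word, whose normalized hikes tend to 0. Neither
probability depends on the length of the block, so the limiting distribution functions satisfy
`F_{k+1}(α₀, …) = G(α₀)(σ⁻¹ F_k(α₁, …) + 1 - σ⁻¹)` (`tendsto_blockMean`). This is also the recursion
of `xiCDF` (`xiCDF_succ`), and induction on `k` applies because the later normalized hikes of a word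
are those of its tail (`normHike_succ`).

For `σ > 1` the limit has atoms at 0, so distribution functions are compared only at points with no
zero coordinate; this suffices for weak convergence. The stick-breaking form follows by continuous
mapping. -/

namespace YoungFib

open scoped Topology

/-! ### Dimensions -/

@[simp] lemma weight_nil : weight [] = 0 := rfl

@[simp] lemma weight_one_cons (w : Word) : weight (Letter.one :: w) = weight w + 1 := by
  simp [weight, Letter.val, add_comm]

@[simp] lemma weight_two_cons (w : Word) : weight (Letter.two :: w) = weight w + 2 := by
  simp [weight, Letter.val, add_comm]

lemma Covers.weight_eq {v w : Word} (h : Covers v w) : weight w = weight v + 1 := by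
  induction h with
  | one v => simp
  | two _ ih => simp [ih]

/-- The list of words covered by a given word. -/
def lowerCovers : Word → List Word
  | [] => []
  | Letter.one :: v => [v]
  | Letter.two :: u => (Letter.one :: u) :: (lowerCovers u).map (Letter.two :: ·)

lemma covers_iff_mem_lowerCovers {v w : Word} : Covers v w ↔ v ∈ lowerCovers w := by
  induction w generalizing v with
  | nil =>
    simp only [lowerCovers, List.not_mem_nil, iff_false]
    intro h
    cases h
  | cons a u ih =>
    cases a with
    | one =>
      simp only [lowerCovers, List.mem_singleton]
      exact ⟨fun h => by cases h; rfl, fun h => h ▸ Covers.one _⟩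
    | two =>
      simp only [lowerCovers, List.mem_cons, List.mem_map]
      constructor
      · intro h
        cases h with
        | two h =>
          cases h with
          | one => exact Or.inl rfl
          | two h => exact Or.inr ⟨_, ih.1 h, rfl⟩
      · rintro (rfl | ⟨u', hu', rfl⟩)
        · exact .two (.one _)
        · exact .two (.two (ih.2 hu'))

lemma nodup_lowerCovers (w : Word) : (lowerCovers w).Nodup := by
  induction w with
  | nil => simp [lowerCovers]
  | cons a u ih =>
    cases a with
    | one => simp [lowerCovers]
    | two =>
      simp only [lowerCovers, List.nodup_cons, List.mem_map]
      exact ⟨by rintro ⟨_, _, h⟩; simp at h, ih.map fun _ _ h => List.tail_eq_of_cons_eq h⟩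

/-- The saturated chains from the empty word to `w`. -/
def chainsTo (w : Word) : Set (List Word) :=
  {c | c.IsChain Covers ∧ c.head? = some [] ∧ c.getLast? = some w}

lemma chainsTo_nil : chainsTo [] = {[[]]} := by
  ext c
  simp only [chainsTo, Set.mem_ofPred_eq, Set.mem_singleton_iff]
  refine ⟨fun ⟨hc, _, hl⟩ => ?_, fun h => by simp [h]⟩
  obtain ⟨c, rfl⟩ := List.getLast?_eq_some_iff.1 hl
  rw [List.isChain_append] at hc
  rcases c.eq_nil_or_concat with rfl | ⟨c', v, rfl⟩
  · rfl
  · exact absurd (hc.2.2 v (by simp) [] (by simp)) (fun h => by cases h)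

lemma chainsTo_eq {w : Word} (hw : w ≠ []) :
    chainsTo w = (fun c => c ++ [w]) '' {c | ∃ v ∈ lowerCovers w, c ∈ chainsTo v} := by
  ext c
  simp only [chainsTo, Set.mem_ofPred_eq, Set.mem_image]
  constructor
  · rintro ⟨hc, hh, hl⟩
    obtain ⟨c, rfl⟩ := List.getLast?_eq_some_iff.1 hl
    refine ⟨c, ?_, rfl⟩
    rw [List.isChain_append] at hc
    rcases c.eq_nil_or_concat with rfl | ⟨c', v, rfl⟩
    · simp [hw] at hh
    · refine ⟨v, covers_iff_mem_lowerCovers.1 (hc.2.2 v (by simp) w (by simp)), hc.1, ?_, by simp⟩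
      rw [List.head?_append_of_ne_nil _ (by simp)] at hh
      exact hh
  · rintro ⟨c, ⟨v, hv, hc, hh, hl⟩, rfl⟩
    refine ⟨?_, ?_, by simp⟩
    · rw [List.isChain_append]
      refine ⟨hc, by simp, fun x hx y hy => ?_⟩
      rw [hl] at hx
      simp only [Option.mem_def, Option.some.injEq, List.head?_cons] at hx hy
      rw [← hx, ← hy]
      exact covers_iff_mem_lowerCovers.2 hv
    · rw [List.head?_append, hh]
      rfl

lemma finite_chainsTo (w : Word) : (chainsTo w).Finite := by
  induction h : weight w using Nat.strong_induction_on generalizing w with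
  | _ n ih =>
    by_cases hw : w = []
    · rw [hw, chainsTo_nil]; exact Set.finite_singleton _
    · rw [chainsTo_eq hw]
      refine Set.Finite.image _ ?_
      have : {c | ∃ v ∈ lowerCovers w, c ∈ chainsTo v} =
          ⋃ v ∈ {v | v ∈ lowerCovers w}, chainsTo v := by ext; simp
      rw [this]
      refine (List.finite_toSet _).biUnion fun v hv => ih (weight v) ?_ v rfl
      have := (covers_iff_mem_lowerCovers.2 hv).weight_eq
      omega

lemma ncard_chainsTo_list (l : List Word) (hl : l.Nodup) :
    {c | ∃ v ∈ l, c ∈ chainsTo v}.ncard = (l.map dim).sum := by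
  induction l with
  | nil => simp
  | cons a l ih =>
    rw [List.nodup_cons] at hl
    have : {c | ∃ v ∈ a :: l, c ∈ chainsTo v} =
        chainsTo a ∪ {c | ∃ v ∈ l, c ∈ chainsTo v} := by ext; simp
    have hfin : {c | ∃ v ∈ l, c ∈ chainsTo v}.Finite := by
      have : {c | ∃ v ∈ l, c ∈ chainsTo v} = ⋃ v ∈ {v | v ∈ l}, chainsTo v := by ext; simp
      rw [this]
      exact (List.finite_toSet _).biUnion fun v _ => finite_chainsTo v
    rw [this, Set.ncard_union_eq ?_ (finite_chainsTo a) hfin, ih hl.2]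
    · rfl
    · rw [Set.disjoint_left]
      rintro c ⟨_, _, h1⟩ ⟨v, hv, _, _, h2⟩
      rw [h1] at h2
      exact hl.1 (Option.some.inj h2 ▸ hv)

lemma dim_eq_sum {w : Word} (hw : w ≠ []) : dim w = ((lowerCovers w).map dim).sum := by
  rw [← ncard_chainsTo_list _ (nodup_lowerCovers w), dim]
  change (chainsTo w).ncard = _
  rw [chainsTo_eq hw, Set.ncard_image_of_injective _ (List.append_left_injective _)]

@[simp] lemma dim_nil : dim [] = 1 := by
  change (chainsTo []).ncard = 1
  rw [chainsTo_nil, Set.ncard_singleton]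

@[simp] lemma dim_one_cons (w : Word) : dim (Letter.one :: w) = dim w := by
  simp [dim_eq_sum, lowerCovers]

-- The word `2w` covers `1w` and the words `2v` with `v` covered by `w`. By induction `dim(2v) = |w|
-- dim v`, and these terms add up to `|w| dim w`.
@[simp] lemma dim_two_cons (w : Word) : dim (Letter.two :: w) = (weight w + 1) * dim w := by
  induction h : weight w using Nat.strong_induction_on generalizing w with
  | _ n ih =>
    rw [dim_eq_sum (by simp), lowerCovers, List.map_cons, List.sum_cons, dim_one_cons, List.map_map]
    have h1 : (lowerCovers w).map (dim ∘ (Letter.two :: ·)) =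
        (lowerCovers w).map fun v => n * dim v := by
      refine List.map_congr_left fun v hv => ?_
      have := (covers_iff_mem_lowerCovers.2 hv).weight_eq
      rw [Function.comp_apply, ih (weight v) (by omega) v rfl]
      congr 1
      omega
    rw [h1, List.sum_map_mul_left]
    by_cases hw : w = []
    · subst hw
      simp at h
      simp [← h]
    · rw [← dim_eq_sum hw]
      ring

/-! ### Tridiagonal determinants -/

@[simp] lemma detA_zero (x y : ℕ → ℝ) : detA x y 0 = 1 := by simp [detA]

@[simp] lemma detA_one (x y : ℕ → ℝ) : detA x y 1 = x 1 := by simp [detA]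

@[simp] lemma shift_zero (x : ℕ → ℝ) : shift x 0 = x := rfl

/-- Laplace expansion along the first row, then along the first column of the second minor. It is
stated for a general `f` so that it serves both `detA` and `detB`. -/
lemma det_tridiagonal_succ_succ (f : ℕ → ℕ → ℝ) (hrow : ∀ j, f 0 (j + 2) = 0)
    (hcol : ∀ i, f (i + 2) 0 = 0) (l : ℕ) :
    (Matrix.of fun i j : Fin (l + 2) => f i j).det =
      f 0 0 * (Matrix.of fun i j : Fin (l + 1) => f (i + 1) (j + 1)).det -
        f 0 1 * f 1 0 * (Matrix.of fun i j : Fin l => f (i + 2) (j + 2)).det := by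
  rw [Matrix.det_succ_row_zero, Fin.sum_univ_succ, Fin.sum_univ_succ, Finset.sum_eq_zero]
  · rw [Matrix.det_succ_column_zero (((Matrix.of fun i j : Fin (l + 2) => f i j).submatrix
      Fin.succ (Fin.succAbove (Fin.succ 0)))), Fin.sum_univ_succ, Finset.sum_eq_zero]
    · have h1 : ((Matrix.of fun i j : Fin (l + 2) => f i j).submatrix Fin.succ
          (Fin.succAbove 0)) = Matrix.of fun i j : Fin (l + 1) => f (i + 1) (j + 1) := by
        ext i j
        simp
      have h2 : (((Matrix.of fun i j : Fin (l + 2) => f i j).submatrix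
          Fin.succ (Fin.succAbove (Fin.succ 0))).submatrix (Fin.succAbove 0) Fin.succ) =
          Matrix.of fun i j : Fin l => f (i + 2) (j + 2) := by
        ext i j
        simp only [Matrix.submatrix_apply, Matrix.of_apply, Fin.succAbove_zero, Fin.val_succ,
          Fin.succ_succAbove_succ]
      rw [h1, h2]
      simp
      ring
    · intro i _
      simp [Fin.succAbove, hcol]
  · intro i _
    simp [hrow]

lemma detA_succ_succ (x y : ℕ → ℝ) (l : ℕ) :
    detA x y (l + 2) = x 1 * detA (shift x 1) (shift y 1) (l + 1)
      - y 1 * detA (shift x 2) (shift y 2) l := by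
  rw [detA, det_tridiagonal_succ_succ (fun i j => if i = j then x (i + 1)
    else if j = i + 1 then y (i + 1) else if i = j + 1 then 1 else 0) (by simp) (by simp)]
  simp [detA, shift, add_assoc]

lemma detB_zero (x y : ℕ → ℝ) : detB x y 0 = y 1 := by simp [detB]

lemma detB_succ (x y : ℕ → ℝ) (k : ℕ) :
    detB x y (k + 1) = y 1 * detA (shift x 2) (shift y 2) (k + 1)
      - x 1 * y 2 * detA (shift x 3) (shift y 3) k := by
  rw [detB, det_tridiagonal_succ_succ (fun i j => if i = 0 then
    (if j = 0 then y 1 else if j = 1 then x 1 * y 2 else 0) else if i = j then x (i + 2)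
    else if j = i + 1 then y (i + 2) else if i = j + 1 then 1 else 0) (by simp) (by simp)]
  simp [detA, shift, add_assoc]

/-- The expansion of `detA` along its last row. -/
lemma detA_succ_succ' (x y : ℕ → ℝ) (l : ℕ) :
    detA x y (l + 2) = x (l + 2) * detA x y (l + 1) - y (l + 1) * detA x y l := by
  induction l using Nat.strong_induction_on generalizing x y with
  | _ l ih =>
    match l with
    | 0 =>
      simp [detA_succ_succ, shift]
      ring
    | 1 =>
      simp [detA_succ_succ, shift]
      ring
    | l + 2 =>
      rw [detA_succ_succ x y (l + 2), ih (l + 1) (by omega) (shift x 1),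
        ih l (by omega) (shift x 2), detA_succ_succ x y (l + 1), detA_succ_succ x y l]
      simp only [shift, add_assoc, Nat.reduceAdd]
      ring

/-- The expansion of `detB` along its last row. -/
lemma detB_succ_succ (x y : ℕ → ℝ) (k : ℕ) :
    detB x y (k + 2) = x (k + 4) * detB x y (k + 1) - y (k + 3) * detB x y k := by
  match k with
  | 0 =>
    simp [detB_succ, detB_zero, detA_succ_succ', shift]
    ring
  | 1 =>
    simp [detB_succ, detA_succ_succ', shift]
    ring
  | k + 2 =>
    rw [detB_succ x y (k + 3), detB_succ x y (k + 2), detB_succ x y (k + 1)]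
    rw [detA_succ_succ' (shift x 2) _ (k + 2), detA_succ_succ' (shift x 3) _ (k + 1)]
    simp only [shift, add_assoc, Nat.reduceAdd]
    ring

/-! ### Clone Schur functions at the shifted Plancherel specializations -/

/-- Substituting `x_{l+2} = y_{l+1} + 1` in the last-row expansion gives `A_{l+2} - A_{l+1} =
y_{l+1} (A_{l+1} - A_l)`, so the differences form a product. The same mechanism works for `detB`. -/
lemma detA_sub (x y : ℕ → ℝ) (h : ∀ k, x (k + 2) = y (k + 1) + 1) (l : ℕ) :
    detA x y (l + 1) - detA x y l = (x 1 - 1) * ∏ i ∈ Finset.range l, y (i + 1) := by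
  induction l with
  | zero => simp
  | succ l ih =>
    rw [Finset.prod_range_succ, ← mul_assoc, ← ih, detA_succ_succ', h]
    ring

lemma detB_sub (x y : ℕ → ℝ) (h : ∀ k, x (k + 3) = y (k + 2) + 1) (k : ℕ) :
    detB x y (k + 1) - detB x y k =
      (y 1 * x 3 - x 1 * y 2 - y 1) * ∏ i ∈ Finset.range k, y (i + 3) := by
  induction k with
  | zero => simp [detB_succ, detB_zero, shift]
  | succ k ih =>
    rw [Finset.prod_range_succ, ← mul_assoc, ← ih, detB_succ_succ, h]
    ring

section

variable {σ x₁ : ℝ}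

@[simp] lemma plancherelX_one : plancherelX σ x₁ 1 = x₁ := by simp [plancherelX]

lemma plancherelX_add_two (k : ℕ) : plancherelX σ x₁ (k + 2) = k + 1 + σ := by
  simp [plancherelX]
  ring

lemma plancherelY_add_one (k : ℕ) : plancherelY σ (k + 1) = k + σ := by
  simp [plancherelY]
  ring

lemma prod_plancherelX_succ (n : ℕ) : ∏ i ∈ Finset.Icc 1 (n + 2), plancherelX σ x₁ i =
    (∏ i ∈ Finset.Icc 1 (n + 1), plancherelX σ x₁ i) * (n + 1 + σ) := by
  rw [Finset.prod_Icc_succ_top (by omega), plancherelX_add_two]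

lemma prod_plancherelX_pos (hσ : 1 ≤ σ) (hx : 0 < x₁) (n : ℕ) :
    0 < ∏ i ∈ Finset.Icc 1 n, plancherelX σ x₁ i := by
  refine Finset.prod_pos fun i hi => ?_
  match i with
  | 0 => simp at hi
  | 1 => simpa
  | i + 2 =>
    rw [plancherelX_add_two]
    positivity

lemma cloneSchur_two_cons (u : Word) :
    cloneSchur (plancherelX σ x₁) (plancherelY σ) (Letter.two :: u) =
      (weight u + σ) * cloneSchur (plancherelX σ x₁) (plancherelY σ) u := by
  rw [cloneSchur, cloneSchurAux, detB_zero, shift, add_comm 1, plancherelY_add_one]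
  rfl

lemma prod_plancherelY (n : ℕ) (hx : x₁ = σ) : ∏ i ∈ Finset.range n, plancherelY σ (i + 1) =
    ∏ i ∈ Finset.Icc 1 n, plancherelX σ x₁ i := by
  induction n with
  | zero => simp
  | succ n ih =>
    rw [Finset.prod_range_succ, ih, Finset.prod_Icc_succ_top (by omega)]
    congr 1
    cases n with
    | zero => simp [hx, plancherelY]
    | succ n =>
      rw [plancherelX_add_two, plancherelY_add_one]
      push_cast
      ring

lemma prod_plancherelY' (n : ℕ) (hx : x₁ = 1) :
    (σ + 1) * ∏ i ∈ Finset.range n, plancherelY σ (i + 3) =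
    ∏ i ∈ Finset.Icc 1 (n + 2), plancherelX σ x₁ i := by
  induction n with
  | zero => simp [Finset.prod_Icc_succ_top, hx, plancherelX]; ring
  | succ n ih =>
    rw [Finset.prod_range_succ, ← mul_assoc, ih, Finset.prod_Icc_succ_top (b := n + 2) (by omega)]
    congr 1

open Classical in
-- Prefix ones are carried by `k`, so only the empty word and words starting with `2` need work. For
-- `1ᵏ2u` the constant of `detB_sub` vanishes when `x₁ = σ`, which leaves `1ᵏ` as the only source of
-- a difference.
lemma cloneSchurAux_sub_of_eq (hx : x₁ = σ) (w : Word) (k : ℕ) :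
    cloneSchurAux (plancherelX σ x₁) (plancherelY σ) (k + 1) w -
      cloneSchurAux (plancherelX σ x₁) (plancherelY σ) k w =
    (σ - 1) * (∏ i ∈ Finset.Icc 1 (k + weight w), plancherelX σ x₁ i) *
      if w = List.replicate (weight w) Letter.one then 1 else 0 := by
  induction w generalizing k with
  | nil =>
    rw [cloneSchurAux, cloneSchurAux, detA_sub, prod_plancherelY k hx]
    · simp [hx]
    · intro k
      rw [plancherelX_add_two, plancherelY_add_one]
      ring
  | cons a w ih =>
    cases a with
    | one =>
      rw [cloneSchurAux, cloneSchurAux, ih, weight_one_cons]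
      rw [show k + 1 + weight w = k + (weight w + 1) by ring]
      simp [List.replicate_succ]
    | two =>
      rw [cloneSchurAux, cloneSchurAux, ← sub_mul, detB_sub]
      · rw [if_neg (by simp [List.replicate_succ])]
        have h1 : shift (plancherelX σ x₁) (weight w) 1 = weight w + σ := by
          rw [shift, add_comm]
          cases weight w with
          | zero => simp [hx]
          | succ n => rw [plancherelX_add_two]; push_cast; ring
        rw [h1]
        simp only [shift, plancherelY, plancherelX]
        rw [if_neg (by omega)]
        push_cast
        ring
      · intro k
        simp only [shift, plancherelY, plancherelX]
        rw [if_neg (by omega)]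
        push_cast
        ring

lemma one_cons_eq_replicate_append (w : Word) :
    Letter.one :: w = List.replicate (weight w + 1 - 2) Letter.one ++ [Letter.two] ↔
      w = List.replicate (weight w - 2) Letter.one ++ [Letter.two] := by
  -- Below weight 2 both truncated differences are 0, and both sides of the equivalence are false.
  rcases Nat.lt_or_ge (weight w) 2 with h | h
  · have h1 : weight w + 1 - 2 = 0 := by omega
    have h2 : weight w - 2 = 0 := by omega
    rw [h1, h2]
    simp only [List.replicate_zero, List.nil_append, List.cons.injEq, reduceCtorEq, false_and,
      false_iff]
    rintro rfl
    simp at h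
  · have h1 : weight w + 1 - 2 = weight w - 2 + 1 := by omega
    rw [h1, List.replicate_succ]
    simp

open Classical in
-- Here the factor `x₁ - 1` of `detA_sub` vanishes, so the words `1ᵏ` contribute nothing and the
-- exception moves to `1ᵏ2`.
lemma cloneSchurAux_sub_of_eq_one (hx : x₁ = 1) (w : Word) (k : ℕ) :
    cloneSchurAux (plancherelX σ x₁) (plancherelY σ) (k + 1) w -
      cloneSchurAux (plancherelX σ x₁) (plancherelY σ) k w =
    (σ - 1) * (∏ i ∈ Finset.Icc 1 (k + weight w), plancherelX σ x₁ i) *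
      if w = List.replicate (weight w - 2) Letter.one ++ [Letter.two] then 1 else 0 := by
  induction w generalizing k with
  | nil =>
    rw [cloneSchurAux, cloneSchurAux, detA_sub]
    · simp [hx]
    · intro k
      rw [plancherelX_add_two, plancherelY_add_one]
      ring
  | cons a w ih =>
    cases a with
    | one =>
      rw [cloneSchurAux, cloneSchurAux, ih, weight_one_cons]
      simp only [one_cons_eq_replicate_append]
      rw [show k + 1 + weight w = k + (weight w + 1) by ring]
    | two =>
      rw [cloneSchurAux, cloneSchurAux, ← sub_mul, detB_sub]
      -- The parameter `x₁` enters the constant of `detB_sub` only when the word after the `2` is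
      -- empty. The constant is then `(σ + 1)(σ - 1)`; otherwise it is 0.
      · rcases Nat.eq_zero_or_pos (weight w) with h | h
        · have hw : w = [] := by
            cases w with
            | nil => rfl
            | cons a w => cases a <;> simp at h
          subst hw
          have h1 : (σ - 1) * ∏ i ∈ Finset.Icc 1 (k + 2), plancherelX σ x₁ i =
              (σ - 1) * ((σ + 1) * ∏ i ∈ Finset.range k, plancherelY σ (i + 3)) := by
            rw [← prod_plancherelY' k hx]
          simp only [weight_two_cons, weight_nil, zero_add, h1]
          simp [shift, plancherelX, plancherelY, hx, cloneSchurAux]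
          ring
        · rw [if_neg]
          · obtain ⟨r, hr⟩ : ∃ r, weight w = r + 1 := ⟨weight w - 1, by omega⟩
            rw [hr]
            simp only [shift, plancherelY, plancherelX]
            rw [if_neg (by omega), if_neg (by omega)]
            push_cast
            ring
          · obtain ⟨r, hr⟩ : ∃ r, weight w = r + 1 := ⟨weight w - 1, by omega⟩
            simp [hr, List.replicate_succ]
      · intro k
        simp only [shift, plancherelY, plancherelX]
        rw [if_neg (by omega)]
        push_cast
        ring

lemma weight_append (v w : Word) : weight (v ++ w) = weight v + weight w := by
  simp [weight]

lemma weight_replicate_one (n : ℕ) : weight (List.replicate n Letter.one) = n := by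
  simp [weight, Letter.val]

lemma dim_replicate_one_append (n : ℕ) (w : Word) :
    dim (List.replicate n Letter.one ++ w) = dim w := by
  induction n with
  | zero => simp
  | succ n ih => simpa [List.replicate_succ] using ih

open Classical in
/-- Prefixing a word by `1` changes its clone Schur function at one exceptional word only. -/
lemma exists_exceptional_words (hx : x₁ = 1 ∨ x₁ = σ) : ∃ e : ℕ → Word,
    (∀ n, 2 ≤ n → weight (e n) = n) ∧ (∀ n, 2 ≤ n → e (n + 1) = Letter.one :: e n) ∧
    (∀ n, dim (e n) = 1) ∧
    ∀ v, cloneSchur (plancherelX σ x₁) (plancherelY σ) (Letter.one :: v) =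
      cloneSchur (plancherelX σ x₁) (plancherelY σ) v +
        (σ - 1) * (∏ i ∈ Finset.Icc 1 (weight v), plancherelX σ x₁ i) *
          if v = e (weight v) then 1 else 0 := by
  rcases hx with hx | hx
  · refine ⟨fun n => List.replicate (n - 2) Letter.one ++ [Letter.two], ?_, ?_, ?_, ?_⟩
    · intro n hn
      simp [weight_append, weight_replicate_one]
      omega
    · intro n hn
      obtain ⟨r, rfl⟩ : ∃ r, n = r + 2 := ⟨n - 2, by omega⟩
      simp [List.replicate_succ]
    · intro n
      simp [dim_replicate_one_append]
    · intro v
      have := cloneSchurAux_sub_of_eq_one (σ := σ) hx v 0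
      rw [zero_add, zero_add] at this
      rw [← this]
      simp [cloneSchur, cloneSchurAux]
  · refine ⟨fun n => List.replicate n Letter.one, ?_, ?_, ?_, ?_⟩
    · intro n hn
      simp [weight_replicate_one]
    · intro n hn
      simp [List.replicate_succ]
    · intro n
      simpa using dim_replicate_one_append n []
    · intro v
      have := cloneSchurAux_sub_of_eq (σ := σ) hx v 0
      rw [zero_add, zero_add] at this
      rw [← this]
      simp [cloneSchur, cloneSchurAux]

lemma cloneSchur_nonneg (hσ : 1 ≤ σ) (hx : x₁ = 1 ∨ x₁ = σ) (w : Word) :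
    0 ≤ cloneSchur (plancherelX σ x₁) (plancherelY σ) w := by
  have hx0 : 0 < x₁ := by rcases hx with h | h <;> linarith
  obtain ⟨e, -, -, -, he⟩ := exists_exceptional_words hx
  induction w with
  | nil => simp [cloneSchur, cloneSchurAux]
  | cons a w ih =>
    cases a with
    | one =>
      rw [he]
      have := prod_plancherelX_pos hσ hx0 (weight w)
      have : 0 ≤ σ - 1 := by linarith
      positivity
    | two =>
      rw [cloneSchur_two_cons]
      positivity

lemma cloneWeight_nonneg (hσ : 1 ≤ σ) (hx : x₁ = 1 ∨ x₁ = σ) (w : Word) :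
    0 ≤ cloneWeight (plancherelX σ x₁) (plancherelY σ) w := by
  have hx0 : 0 < x₁ := by rcases hx with h | h <;> linarith
  have := prod_plancherelX_pos hσ hx0 (weight w)
  have := cloneSchur_nonneg hσ hx w
  rw [cloneWeight]
  positivity

open Classical in
/-- The recursion for the weights of the coherent measures of the shifted Plancherel
specializations; `e n` is the exceptional word of weight `n`. -/
structure IsPlancherelWeight (σ : ℝ) (W : Word → ℝ) (e : ℕ → Word) : Prop where
  nonneg : ∀ w, 0 ≤ W w
  nil : W [] = 1
  one : W [Letter.one] = 1
  -- The two separate weights depend on the choice of `x₁`; their sum does not, and it is all that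
  -- is needed.
  two : W [Letter.one, Letter.one] + W [Letter.two] = 1
  one_cons : ∀ v, 2 ≤ weight v → W (Letter.one :: v) =
    (W v + (σ - 1) * if v = e (weight v) then 1 else 0) / (weight v + σ)
  two_cons : ∀ u, 1 ≤ weight u → W (Letter.two :: u) =
    (weight u + 1) / (weight u + 1 + σ) * W u
  weight_exc : ∀ n, 2 ≤ n → weight (e n) = n
  exc_succ : ∀ n, 2 ≤ n → e (n + 1) = Letter.one :: e n

open Classical in
lemma exists_isPlancherelWeight (hσ : 1 ≤ σ) (hx : x₁ = 1 ∨ x₁ = σ) :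
    ∃ e, IsPlancherelWeight σ (cloneWeight (plancherelX σ x₁) (plancherelY σ)) e := by
  have hx0 : 0 < x₁ := by rcases hx with h | h <;> linarith
  obtain ⟨e, hw, hs, hd, he⟩ := exists_exceptional_words hx
  refine ⟨e, cloneWeight_nonneg hσ hx, ?_, ?_, ?_, ?_, ?_, hw, hs⟩
  · simp [cloneWeight, cloneSchur, cloneSchurAux]
  · simp [cloneWeight, cloneSchur, cloneSchurAux, hx0.ne']
  · simp [cloneWeight, cloneSchur, cloneSchurAux, detB_zero, detA_succ_succ',
      Finset.prod_Icc_succ_top, plancherelX, plancherelY]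
    have : (2 + σ - 1) ≠ 0 := by linarith
    field_simp
    ring
  · intro v hv
    obtain ⟨r, hr⟩ : ∃ r, weight v = r + 1 := ⟨weight v - 1, by omega⟩
    have h1 : 0 < (r : ℝ) + 1 + σ := by positivity
    have hp := prod_plancherelX_pos hσ hx0 (r + 1)
    rw [cloneWeight, cloneWeight, he, dim_one_cons, weight_one_cons, hr, prod_plancherelX_succ]
    rw [show (dim v : ℝ) * ((cloneSchur (plancherelX σ x₁) (plancherelY σ) v +
      (σ - 1) * (∏ i ∈ Finset.Icc 1 (r + 1), plancherelX σ x₁ i) *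
        if v = e (r + 1) then 1 else 0) / ((∏ i ∈ Finset.Icc 1 (r + 1), plancherelX σ x₁ i) *
          (r + 1 + σ))) = (dim v * (cloneSchur (plancherelX σ x₁) (plancherelY σ) v /
          ∏ i ∈ Finset.Icc 1 (r + 1), plancherelX σ x₁ i) + (σ - 1) * (dim v *
        if v = e (r + 1) then 1 else 0)) / (r + 1 + σ) by field_simp]
    split_ifs with h
    · rw [h, hd]
      simp
    · simp
  · intro u hu
    obtain ⟨r, hr⟩ : ∃ r, weight u = r + 1 := ⟨weight u - 1, by omega⟩
    have h1 : 0 < (r : ℝ) + 1 + σ := by positivity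
    have h2 : 0 < (r : ℝ) + 1 + 1 + σ := by positivity
    have hp := prod_plancherelX_pos hσ hx0 (r + 1)
    rw [cloneWeight, cloneWeight, cloneSchur_two_cons, dim_two_cons, weight_two_cons, hr,
      prod_plancherelX_succ (r + 1), prod_plancherelX_succ]
    push_cast
    field_simp

end

/-! ### Hikes -/

lemma hikes_ne_nil (w : Word) : hikes w ≠ [] := by
  induction w with
  | nil => simp [hikes]
  | cons a w ih => cases a <;> simp [hikes, ih]

lemma hTilde_nil (j : ℕ) : hTilde [] j = 0 := by
  simp [hTilde, hikes]

lemma hTilde_one_cons_zero (w : Word) : hTilde (Letter.one :: w) 0 = 1 := by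
  simp [hTilde, hikes, List.length_pos_iff.2 (hikes_ne_nil w)]

lemma hTilde_one_cons_succ (w : Word) (j : ℕ) :
    hTilde (Letter.one :: w) (j + 1) = hTilde w j := by
  simp [hTilde, hikes]

lemma hTilde_two_cons_zero (w : Word) : hTilde (Letter.two :: w) 0 = hTilde w 0 + 2 := by
  obtain ⟨a, l, h⟩ := List.exists_cons_of_ne_nil (hikes_ne_nil w)
  simp only [hTilde, hikes, h, List.modifyHead_cons, List.length_cons, List.getD_cons_zero]
  split_ifs <;> omega

lemma hTilde_two_cons_succ (w : Word) (j : ℕ) :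
    hTilde (Letter.two :: w) (j + 1) = hTilde w (j + 1) := by
  obtain ⟨a, l, h⟩ := List.exists_cons_of_ne_nil (hikes_ne_nil w)
  simp [hTilde, hikes, h]

/-- The part of a word after its first letter `1`. -/
def tailWord : Word → Word
  | [] => []
  | Letter.one :: w => w
  | Letter.two :: w => tailWord w

lemma hTilde_succ (w : Word) (j : ℕ) : hTilde w (j + 1) = hTilde (tailWord w) j := by
  induction w with
  | nil => simp [tailWord, hTilde_nil]
  | cons a w ih =>
    cases a with
    | one => rw [hTilde_one_cons_succ, tailWord]
    | two => rw [hTilde_two_cons_succ, tailWord, ih]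

lemma hTilde_zero_add_weight (w : Word) : hTilde w 0 + weight (tailWord w) = weight w := by
  induction w with
  | nil => simp [tailWord, hTilde_nil]
  | cons a w ih =>
    cases a with
    | one => rw [hTilde_one_cons_zero, tailWord, weight_one_cons, add_comm]
    | two => rw [hTilde_two_cons_zero, tailWord, weight_two_cons, ← ih]; ring

lemma hTilde_zero_le (w : Word) : hTilde w 0 ≤ weight w := by
  have := hTilde_zero_add_weight w
  omega

lemma one_le_hTilde_zero {w : Word} (hw : w ≠ []) : 1 ≤ hTilde w 0 := by
  cases w with
  | nil => exact absurd rfl hw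
  | cons a w =>
    cases a with
    | one => rw [hTilde_one_cons_zero]
    | two => rw [hTilde_two_cons_zero]; omega

/-- The normalized hike `h̃_j / (|w| - h̃_1 - ⋯ - h̃_{j-1})` of a word. -/
noncomputable def normHike (w : Word) (j : ℕ) : ℝ :=
  (hTilde w j : ℝ) / ((weight w : ℝ) - ∑ i ∈ Finset.range j, (hTilde w i : ℝ))

/-- The denominator of a normalized hike is the weight left after the earlier blocks, and removing
the first block lowers the total weight by exactly `h̃_1`. -/
lemma normHike_succ (w : Word) (j : ℕ) : normHike w (j + 1) = normHike (tailWord w) j := by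
  have := hTilde_zero_add_weight w
  rw [normHike, normHike, hTilde_succ, Finset.sum_range_succ', ← this]
  simp only [hTilde_succ]
  push_cast
  congr 1
  ring

lemma normHike_zero (w : Word) : normHike w 0 = hTilde w 0 / weight w := by simp [normHike]

lemma normHike_nonneg (w : Word) (j : ℕ) : 0 ≤ normHike w j := by
  induction j generalizing w with
  | zero => rw [normHike_zero]; positivity
  | succ j ih => rw [normHike_succ]; exact ih _

lemma normHike_le_one (w : Word) (j : ℕ) : normHike w j ≤ 1 := by
  induction j generalizing w with
  | zero =>
    rw [normHike_zero]
    exact div_le_one_of_le₀ (by exact_mod_cast hTilde_zero_le w) (by positivity)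
  | succ j ih => rw [normHike_succ]; exact ih _

/-! ### Sums over the words of a given weight -/

/-- The sum of `g w` over the Fibonacci words `w` of weight `n`. -/
def wordSum : ℕ → (Word → ℝ) → ℝ
  | 0, g => g []
  | 1, g => g [Letter.one]
  | n + 2, g => wordSum (n + 1) (fun w => g (Letter.one :: w)) +
      wordSum n (fun w => g (Letter.two :: w))

lemma wordSum_le {g g' : Word → ℝ} (n : ℕ) (h : ∀ w, weight w = n → g w ≤ g' w) :
    wordSum n g ≤ wordSum n g' := by
  induction n using Nat.twoStepInduction generalizing g g' with
  | zero => exact h [] rfl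
  | one => exact h [Letter.one] rfl
  | more n h0 h1 =>
    exact add_le_add (h1 fun w hw => h _ (by simp [hw])) (h0 fun w hw => h _ (by simp [hw]))

lemma wordSum_congr {g g' : Word → ℝ} (n : ℕ) (h : ∀ w, weight w = n → g w = g' w) :
    wordSum n g = wordSum n g' :=
  le_antisymm (wordSum_le n fun w hw => (h w hw).le) (wordSum_le n fun w hw => (h w hw).ge)

lemma wordSum_add (g g' : Word → ℝ) (n : ℕ) :
    wordSum n (fun w => g w + g' w) = wordSum n g + wordSum n g' := by
  induction n using Nat.twoStepInduction generalizing g g' with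
  | zero => rfl
  | one => rfl
  | more n h0 h1 =>
    simp only [wordSum, h0, h1]
    ring

lemma wordSum_mul (c : ℝ) (g : Word → ℝ) (n : ℕ) :
    wordSum n (fun w => c * g w) = c * wordSum n g := by
  induction n using Nat.twoStepInduction generalizing g with
  | zero => rfl
  | one => rfl
  | more n h0 h1 =>
    simp only [wordSum, h0, h1]
    ring

lemma wordSum_zero (n : ℕ) : wordSum n (fun _ => 0) = 0 := by
  simpa using wordSum_mul 0 (fun _ => 0) n

open Classical in
lemma wordSum_ite_eq (g : Word → ℝ) (n : ℕ) {v : Word} (hv : weight v = n) :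
    wordSum n (fun w => if w = v then g w else 0) = g v := by
  induction n using Nat.twoStepInduction generalizing g v with
  | zero =>
    rcases v with _ | ⟨_ | _, v⟩ <;> simp at hv
    simp [wordSum]
  | one =>
    rcases v with _ | ⟨_ | _, _ | ⟨_ | _, v⟩⟩ <;> simp at hv
    simp [wordSum]
  | more n h0 h1 =>
    rcases v with _ | ⟨_ | _, v⟩
    · simp at hv
    · simp only [wordSum, List.cons.injEq, true_and, reduceCtorEq, false_and, if_false,
        wordSum_zero, add_zero]
      exact h1 (fun w => g (Letter.one :: w)) (by simpa using hv)
    · simp only [wordSum, List.cons.injEq, true_and, reduceCtorEq, false_and, if_false,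
        wordSum_zero, zero_add]
      exact h0 (fun w => g (Letter.two :: w)) (by simpa using hv)

/-- The expectation of `f` with respect to the weights `W` of the words of weight `n`. -/
def wordMean (W : Word → ℝ) (n : ℕ) (f : Word → ℝ) : ℝ := wordSum n fun w => W w * f w

/-! ### The recursion for expectations -/

section

variable {σ : ℝ} {W : Word → ℝ} {e : ℕ → Word}

lemma wordMean_congr {f g : Word → ℝ} (n : ℕ) (h : ∀ w, weight w = n → f w = g w) :
    wordMean W n f = wordMean W n g :=
  wordSum_congr n fun w hw => by rw [h w hw]

/-- The one-step description of the random word. The cases `1v` and `2u` come from `one_cons` and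
`two_cons`; the correction at `v = e (n + 2)` becomes a point mass at `e (n + 3)`. -/
lemma wordMean_add_three (hW : IsPlancherelWeight σ W e) (n : ℕ) (f : Word → ℝ) :
    wordMean W (n + 3) f = (wordMean W (n + 2) (fun w => f (Letter.one :: w)) +
      (σ - 1) * f (e (n + 3)) + (n + 2) * wordMean W (n + 1) fun w => f (Letter.two :: w)) /
        (n + 2 + σ) := by
  classical
  have h1 : wordSum (n + 2) (fun w => W (Letter.one :: w) * f (Letter.one :: w)) =
      1 / (n + 2 + σ) * (wordMean W (n + 2) (fun w => f (Letter.one :: w)) +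
      (σ - 1) * f (Letter.one :: e (n + 2))) := by
    rw [← wordSum_ite_eq (fun w => f (Letter.one :: w)) (n + 2)
      (hW.weight_exc (n + 2) (by omega)), ← wordSum_mul, wordMean, ← wordSum_add, ← wordSum_mul]
    refine wordSum_congr _ fun w hw => ?_
    rw [hW.one_cons w (by omega), hw]
    push_cast
    split_ifs <;> ring
  have h2 : wordSum (n + 1) (fun w => W (Letter.two :: w) * f (Letter.two :: w)) =
      (n + 2) / (n + 2 + σ) * wordMean W (n + 1) (fun w => f (Letter.two :: w)) := by
    rw [wordMean, ← wordSum_mul]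
    refine wordSum_congr _ fun w hw => ?_
    rw [hW.two_cons w (by omega), hw]
    push_cast
    ring
  rw [wordMean, wordSum, h1, h2, hW.exc_succ (n + 2) (by omega)]
  ring

lemma wordMean_mono (hW : IsPlancherelWeight σ W e) {f g : Word → ℝ} (n : ℕ)
    (h : ∀ w, weight w = n → f w ≤ g w) : wordMean W n f ≤ wordMean W n g :=
  wordSum_le n fun w hw => mul_le_mul_of_nonneg_left (h w hw) (hW.nonneg w)

lemma wordMean_const (hW : IsPlancherelWeight σ W e) (hσ : 1 ≤ σ) (n : ℕ) (c : ℝ) :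
    wordMean W n (fun _ => c) = c := by
  induction n using Nat.strong_induction_on with
  | _ n ih =>
    match n with
    | 0 => simp [wordMean, wordSum, hW.nil]
    | 1 => simp [wordMean, wordSum, hW.one]
    | 2 =>
      have := hW.two
      simp [wordMean, wordSum, ← add_mul, this]
    | n + 3 =>
      rw [wordMean_add_three hW, ih _ (by omega), ih _ (by omega)]
      have : 0 < (n : ℝ) + 2 + σ := by positivity
      field_simp
      ring

lemma wordMean_mem_Icc (hW : IsPlancherelWeight σ W e) (hσ : 1 ≤ σ) {f : Word → ℝ}
    (hf : ∀ w, f w ∈ Set.Icc (0 : ℝ) 1) (n : ℕ) : wordMean W n f ∈ Set.Icc (0 : ℝ) 1 :=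
  ⟨(wordMean_const hW hσ n 0).ge.trans (wordMean_mono hW n fun w _ => (hf w).1),
    (wordMean_mono hW n fun w _ => (hf w).2).trans (wordMean_const hW hσ n 1).le⟩

/-- The expectation of `φ` of the tail of a word, on the event that the first block is at most
`t`. -/
noncomputable def blockMean (W : Word → ℝ) (n : ℕ) (t : ℝ) (φ : Word → ℝ) : ℝ :=
  wordMean W n fun w => if (hTilde w 0 : ℝ) ≤ t then φ (tailWord w) else 0

lemma blockMean_add_three (hW : IsPlancherelWeight σ W e) (hσ : 1 ≤ σ) (n : ℕ) (t : ℝ)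
    (φ : Word → ℝ) : blockMean W (n + 3) t φ =
      ((if 1 ≤ t then wordMean W (n + 2) φ + (σ - 1) * φ (e (n + 2)) else 0) +
        (n + 2) * blockMean W (n + 1) (t - 2) φ) / (n + 2 + σ) := by
  rw [blockMean, wordMean_add_three hW, hW.exc_succ (n + 2) (by omega)]
  simp only [hTilde_one_cons_zero, hTilde_two_cons_zero, tailWord, Nat.cast_one, Nat.cast_add,
    Nat.cast_ofNat]
  congr 2
  · split_ifs
    · rfl
    · simp [wordMean_const hW hσ]
  · simp [blockMean, le_sub_iff_add_le]

lemma blockMean_mem_Icc (hW : IsPlancherelWeight σ W e) (hσ : 1 ≤ σ) {φ : Word → ℝ}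
    (hφ : ∀ w, φ w ∈ Set.Icc (0 : ℝ) 1) (n : ℕ) (t : ℝ) :
    blockMean W n t φ ∈ Set.Icc (0 : ℝ) 1 := by
  refine wordMean_mem_Icc hW hσ (fun w => ?_) n
  split_ifs
  · exact hφ _
  · simp

/-! ### The first block -/

/-- From `1 - u ≤ exp(-u)` and `log(1 + u) ≤ u`. The right side is a ratio of values of one function
at arguments two apart, so it telescopes when the weight drops by 2. -/
lemma sub_div_le_rpow (hσ : 1 ≤ σ) {x : ℝ} (hx : 0 < x) :
    x / (x + σ) ≤ ((x + σ) / (x + σ + 2)) ^ (σ / 2) := by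
  have h0 : 0 < (x + σ) / (x + σ + 2) := by positivity
  have h1 : -(2 / (x + σ)) ≤ Real.log ((x + σ) / (x + σ + 2)) := by
    have := Real.log_le_sub_one_of_pos (inv_pos.2 h0)
    rw [Real.log_inv] at this
    have h2 : ((x + σ) / (x + σ + 2))⁻¹ - 1 = 2 / (x + σ) := by field_simp; ring
    linarith
  rw [Real.rpow_def_of_pos h0]
  calc x / (x + σ) = -(σ / (x + σ)) + 1 := by field_simp; ring
    _ ≤ Real.exp (-(σ / (x + σ))) := Real.add_one_le_exp _
    _ ≤ _ := by
      refine Real.exp_le_exp.2 ?_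
      have := mul_le_mul_of_nonneg_right h1 (by positivity : 0 ≤ σ / 2)
      refine le_trans (le_of_eq ?_) this
      field_simp

/-- The companion lower bound, again telescoping in steps of two. -/
lemma rpow_le_sub_div (hσ : 1 ≤ σ) {x : ℝ} (hx : 2 < x) :
    ((x - 2) / x) ^ (σ / 2) ≤ x / (x + σ) := by
  have h0 : 0 < (x - 2) / x := div_pos (by linarith) (by linarith)
  have h1 : Real.log ((x - 2) / x) ≤ -(2 / x) := by
    have := Real.log_le_sub_one_of_pos h0
    refine this.trans (le_of_eq ?_)
    field_simp
    ring
  rw [Real.rpow_def_of_pos h0]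
  calc _ ≤ Real.exp (-(σ / x)) := by
        refine Real.exp_le_exp.2 ?_
        have := mul_le_mul_of_nonneg_right h1 (by positivity : 0 ≤ σ / 2)
        refine this.trans (le_of_eq ?_)
        field_simp
    _ ≤ (σ / x + 1)⁻¹ := by
        rw [Real.exp_neg]
        exact inv_anti₀ (by positivity) (Real.add_one_le_exp _)
    _ = _ := by field_simp; ring

lemma blockMean_one_eq_zero (hW : IsPlancherelWeight σ W e) (hσ : 1 ≤ σ) {n : ℕ} (hn : 1 ≤ n)
    {t : ℝ} (ht : t < 1) (φ : Word → ℝ) : blockMean W n t φ = 0 := by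
  rw [← wordMean_const hW hσ n 0]
  refine wordMean_congr n fun w hw => if_neg ?_
  have : 1 ≤ hTilde w 0 := one_le_hTilde_zero (by rintro rfl; simp at hw; omega)
  have : (1 : ℝ) ≤ hTilde w 0 := by exact_mod_cast this
  linarith

lemma blockMean_one_eq_one (hW : IsPlancherelWeight σ W e) (hσ : 1 ≤ σ) {n : ℕ}
    {t : ℝ} (ht : n ≤ t) : blockMean W n t (fun _ => 1) = 1 := by
  refine Eq.trans (wordMean_congr n fun w hw => if_pos ?_) (wordMean_const hW hσ n 1)
  have : (hTilde w 0 : ℝ) ≤ weight w := by exact_mod_cast hTilde_zero_le w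
  rw [hw] at this
  linarith

/-- For `t ≥ 1` a first block larger than `t` must begin with `2`, and the first block of the rest
must exceed `t - 2`. -/
lemma one_sub_blockMean_add_three (hW : IsPlancherelWeight σ W e) (hσ : 1 ≤ σ) (n : ℕ) {t : ℝ}
    (ht : 1 ≤ t) : 1 - blockMean W (n + 3) t (fun _ => 1) =
      (n + 2) / (n + 2 + σ) * (1 - blockMean W (n + 1) (t - 2) fun _ => 1) := by
  rw [blockMean_add_three hW hσ, if_pos ht, wordMean_const hW hσ]
  have : 0 < (n : ℝ) + 2 + σ := by positivity
  field_simp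
  ring

/-- The difference `n - t` is invariant under `(n, t) ↦ (n - 2, t - 2)`, so only the denominator
changes, by the factor in `sub_div_le_rpow`. The constant `σ + 3` makes the bound at least 1 once `t
≤ 2`. -/
lemma one_sub_blockMean_le (hW : IsPlancherelWeight σ W e) (hσ : 1 ≤ σ) (n : ℕ) (t : ℝ) :
    1 - blockMean W n t (fun _ => 1) ≤ (max (n - t + σ + 3) 0 / (n + σ + 1)) ^ (σ / 2) := by
  induction n using Nat.strong_induction_on generalizing t with
  | _ n ih =>
    by_cases h2 : t ≤ 2
    · refine le_trans (?_ : _ ≤ (1 : ℝ)) (Real.one_le_rpow ?_ (by positivity))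
      · linarith [(blockMean_mem_Icc hW hσ (φ := fun _ => 1) (by simp) n t).1]
      · rw [one_le_div (by positivity)]
        refine le_max_of_le_left (by linarith)
    by_cases hn : n ≤ t
    · rw [blockMean_one_eq_one hW hσ hn, sub_self]
      positivity
    have : 2 < n := by
      have : (2 : ℝ) < n := by linarith
      exact_mod_cast this
    obtain ⟨m, rfl⟩ : ∃ m, n = m + 3 := ⟨n - 3, by omega⟩
    rw [one_sub_blockMean_add_three hW hσ m (by linarith)]
    have h3 := ih (m + 1) (by omega) (t - 2)
    have h4 := sub_div_le_rpow hσ (x := m + 2) (by positivity)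
    refine (mul_le_mul h4 h3 ?_ (by positivity)).trans (le_of_eq ?_)
    · linarith [(blockMean_mem_Icc hW hσ (φ := fun _ => 1) (by simp) (m + 1) (t - 2)).2]
    · rw [← Real.mul_rpow (by positivity) (by positivity)]
      congr 1
      push_cast
      have h5 : (m : ℝ) + 1 - (t - 2) + σ + 3 = m + 3 - t + σ + 3 := by ring
      have h6 : (m : ℝ) + 1 + σ + 1 = m + 2 + σ := by ring
      rw [h5, h6]
      have : 0 < (m : ℝ) + 2 + σ := by positivity
      field_simp
      ring

/-- The same telescoping from below. The condition `-1 ≤ t` is kept by the step from `t ≥ 1` to `t -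
2`, and it makes the bound at most 1 in the base case `t < 1`. -/
lemma le_one_sub_blockMean (hW : IsPlancherelWeight σ W e) (hσ : 1 ≤ σ) (n : ℕ) (hn : 2 ≤ n)
    (t : ℝ) (ht : -1 ≤ t) :
    (max (n - 2 - t) 0 / (n - 1)) ^ (σ / 2) ≤ 1 - blockMean W n t (fun _ => 1) := by
  induction n using Nat.strong_induction_on generalizing t with
  | _ n ih =>
    have hn' : (2 : ℝ) ≤ n := by exact_mod_cast hn
    by_cases h1 : t < 1
    · rw [blockMean_one_eq_zero hW hσ (by omega) h1, sub_zero]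
      refine Real.rpow_le_one (div_nonneg (le_max_right _ _) (by linarith)) ?_ (by positivity)
      refine div_le_one_of_le₀ (max_le ?_ ?_) ?_ <;> linarith
    by_cases h2 : (n : ℝ) - 2 - t ≤ 0
    · rw [max_eq_right h2, zero_div, Real.zero_rpow (by positivity)]
      linarith [(blockMean_mem_Icc hW hσ (φ := fun _ => 1) (by simp) n t).2]
    have : 3 < n := by
      have : (3 : ℝ) < n := by linarith
      exact_mod_cast this
    obtain ⟨m, rfl⟩ : ∃ m, n = m + 1 + 3 := ⟨n - 4, by omega⟩
    rw [one_sub_blockMean_add_three hW hσ (m + 1) (by linarith)]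
    have h3 := ih (m + 1 + 1) (by omega) (by omega) (t - 2) (by linarith)
    have h4 := rpow_le_sub_div hσ (x := (m + 1 : ℕ) + 2) (by push_cast; linarith)
    refine le_trans (le_of_eq ?_) (mul_le_mul h4 h3 (Real.rpow_nonneg
      (div_nonneg (le_max_right _ _) (by push_cast; linarith)) _) (by positivity))
    push_cast at h2 ⊢
    rw [max_eq_left (by linarith), max_eq_left (by linarith),
      ← Real.mul_rpow (div_nonneg (by linarith) (by positivity))
      (div_nonneg (by linarith) (by linarith))]
    congr 1
    have h5 : (m : ℝ) + 1 + 1 - 1 = m + 1 := by ring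
    have h6 : (m : ℝ) + 1 + 2 - 2 = m + 1 := by ring
    have h7 : (m : ℝ) + 1 + 3 - 1 = m + 3 := by ring
    rw [h5, h6, h7]
    field_simp
    ring

end

/-! ### Scaling limit of the joint distribution functions -/

section

variable {σ : ℝ} {W : Word → ℝ} {e : ℕ → Word}

lemma tendsto_blockMean_one (hW : IsPlancherelWeight σ W e) (hσ : 1 ≤ σ) {α : ℝ}
    (hα : α ∈ Set.Icc (0 : ℝ) 1) :
    Tendsto (fun n : ℕ => blockMean W n (α * n) fun _ => 1) atTop (𝓝 (betaCDF σ α)) := by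
  have hn : Tendsto (fun n : ℕ => (n : ℝ)⁻¹) atTop (𝓝 0) := tendsto_inv_atTop_nhds_zero_nat
  have key : Tendsto (fun n : ℕ => 1 - blockMean W n (α * n) fun _ => 1) atTop
      (𝓝 ((1 - α) ^ (σ / 2))) := by
    have hmax : max (1 - α) 0 = 1 - α := max_eq_left (by linarith [hα.2])
    refine tendsto_of_tendsto_of_tendsto_of_le_of_le'
      (f := fun n : ℕ => 1 - blockMean W n (α * n) fun _ => 1)
      (g := fun n : ℕ => (max ((1 - α) - 2 * (n : ℝ)⁻¹) 0 / (1 - (n : ℝ)⁻¹)) ^ (σ / 2))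
      (h := fun n : ℕ => (max ((1 - α) + (σ + 3) * (n : ℝ)⁻¹) 0 /
        (1 + (σ + 1) * (n : ℝ)⁻¹)) ^ (σ / 2)) ?_ ?_ ?_ ?_
    · refine Tendsto.rpow_const ?_ (Or.inr (by positivity))
      have h1 : Tendsto (fun n : ℕ => (1 - α) - 2 * (n : ℝ)⁻¹) atTop (𝓝 ((1 - α) - 2 * 0)) :=
        tendsto_const_nhds.sub (hn.const_mul 2)
      have h2 : Tendsto (fun n : ℕ => 1 - (n : ℝ)⁻¹) atTop (𝓝 (1 - 0)) :=
        tendsto_const_nhds.sub hn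
      have := (h1.max (tendsto_const_nhds (x := (0 : ℝ)))).div h2 (by norm_num)
      simpa [hmax, Pi.div_def] using this
    · refine Tendsto.rpow_const ?_ (Or.inr (by positivity))
      have h1 : Tendsto (fun n : ℕ => (1 - α) + (σ + 3) * (n : ℝ)⁻¹) atTop
          (𝓝 ((1 - α) + (σ + 3) * 0)) := tendsto_const_nhds.add (hn.const_mul _)
      have h2 : Tendsto (fun n : ℕ => 1 + (σ + 1) * (n : ℝ)⁻¹) atTop (𝓝 (1 + (σ + 1) * 0)) :=
        tendsto_const_nhds.add (hn.const_mul _)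
      have := (h1.max (tendsto_const_nhds (x := (0 : ℝ)))).div h2 (by norm_num)
      simpa [hmax, Pi.div_def] using this
    · filter_upwards [eventually_ge_atTop 2] with n hn2
      have hn0 : (0 : ℝ) < n := by positivity
      refine le_trans (le_of_eq ?_) (le_one_sub_blockMean hW hσ n hn2 (α * n)
        (by linarith [mul_nonneg hα.1 hn0.le]))
      congr 1
      rw [← mul_div_mul_right _ _ hn0.ne', max_mul_of_nonneg _ _ hn0.le]
      congr 2
      · field_simp
        ring
      · simp
      · field_simp
    · filter_upwards [eventually_ge_atTop 1] with n hn1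
      have hn0 : (0 : ℝ) < n := by positivity
      refine (one_sub_blockMean_le hW hσ n (α * n)).trans (le_of_eq ?_)
      congr 1
      rw [← mul_div_mul_right (max (1 - α + (σ + 3) * (n : ℝ)⁻¹) 0) _ hn0.ne',
        max_mul_of_nonneg _ _ hn0.le]
      congr 2
      · field_simp
        ring
      · simp
      · field_simp
        ring
  simpa [betaCDF] using key.const_sub 1

/-- If the first block ends while the remaining weight is large, the conditional mean of `φ` on the
tail is within `ε` of `θ`. The power term allows for the first block lasting until the remaining
weight is at most `M`; it decays by `sub_div_le_rpow`, and it is at least 1 for `n ≤ M`, where the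
estimate is trivial. -/
lemma abs_blockMean_sub_le (hW : IsPlancherelWeight σ W e) (hσ : 1 ≤ σ) {φ : Word → ℝ}
    (hφ : ∀ w, φ w ∈ Set.Icc (0 : ℝ) 1) {θ ε : ℝ} (hθ : θ ∈ Set.Icc (0 : ℝ) 1) (hε : 0 ≤ ε)
    {M : ℕ} (hM2 : 2 ≤ M)
    (hM : ∀ m ≥ M, |wordMean W m φ + (σ - 1) * φ (e m) - σ * θ| ≤ σ * ε) (n : ℕ) (t : ℝ) :
    |blockMean W n t φ - θ * blockMean W n t (fun _ => 1)| ≤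
      ε + ((M + σ + 1) / (n + σ + 1)) ^ (σ / 2) := by
  induction n using Nat.strong_induction_on generalizing t with
  | _ n ih =>
    by_cases hn : n ≤ M
    · have h1 : (1 : ℝ) ≤ ((M + σ + 1) / (n + σ + 1)) ^ (σ / 2) := by
        refine Real.one_le_rpow ?_ (by positivity)
        rw [one_le_div (by positivity)]
        have : (n : ℝ) ≤ M := by exact_mod_cast hn
        linarith
      have h2 := blockMean_mem_Icc hW hσ hφ n t
      have h3 := blockMean_mem_Icc hW hσ (φ := fun _ => 1) (by simp) n t
      have h4 := mul_nonneg hθ.1 h3.1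
      have h5 := mul_le_one₀ hθ.2 h3.1 h3.2
      rw [abs_le]
      constructor <;> linarith [h2.1, h2.2]
    obtain ⟨m, rfl⟩ : ∃ m, n = m + 3 := ⟨n - 3, by omega⟩
    have h0 : 0 < (m : ℝ) + 2 + σ := by positivity
    have h1 := ih (m + 1) (by omega) (t - 2)
    have h2 := hM (m + 2) (by omega)
    have h3 := sub_div_le_rpow hσ (x := m + 2) (by positivity)
    rw [blockMean_add_three hW hσ, blockMean_add_three hW hσ, wordMean_const hW hσ]
    set B := ((M + σ + 1) / ((m + 1 : ℕ) + σ + 1)) ^ (σ / 2) with hB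
    have hB0 : 0 ≤ B := by positivity
    have h4 : (m + 2) / (m + 2 + σ) * B ≤ ((M + σ + 1) / ((m + 3 : ℕ) + σ + 1)) ^ (σ / 2) := by
      refine (mul_le_mul_of_nonneg_right h3 hB0).trans (le_of_eq ?_)
      rw [hB, ← Real.mul_rpow (by positivity) (by positivity)]
      congr 1
      push_cast
      have h6 : (m : ℝ) + 1 + σ + 1 = m + 2 + σ := by ring
      rw [h6]
      field_simp
      ring
    have h5 : |(if 1 ≤ t then wordMean W (m + 2) φ + (σ - 1) * φ (e (m + 2)) else 0) -
        θ * if 1 ≤ t then 1 + (σ - 1) * 1 else 0| ≤ σ * ε := by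
      split_ifs
      · convert h2 using 2
        ring
      · simpa using by positivity
    refine le_trans ?_ (add_le_add_right h4 ε)
    set X := if 1 ≤ t then wordMean W (m + 2) φ + (σ - 1) * φ (e (m + 2)) else 0
    set Y : ℝ := if 1 ≤ t then 1 + (σ - 1) * 1 else 0
    set R := blockMean W (m + 1) (t - 2) φ
    set Q := blockMean W (m + 1) (t - 2) fun _ => 1
    have h6 : (X + (m + 2) * R) / (m + 2 + σ) - θ * ((Y + (m + 2) * Q) / (m + 2 + σ)) =
        ((X - θ * Y) + (m + 2) * (R - θ * Q)) / (m + 2 + σ) := by ring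
    rw [h6, abs_div, abs_of_pos h0, div_le_iff₀ h0]
    calc |X - θ * Y + (m + 2) * (R - θ * Q)| ≤ |X - θ * Y| + |(m + 2) * (R - θ * Q)| :=
          abs_add_le _ _
      _ ≤ σ * ε + (m + 2) * (ε + B) := by
          rw [abs_mul, abs_of_nonneg (by positivity : (0 : ℝ) ≤ m + 2)]
          gcongr
      _ = _ := by field_simp; ring

/-- Asymptotic independence of the first block and what follows it. The second factor is the mixture
of `c`, for a fresh word, and 1, for an exceptional word, with weights `σ⁻¹` and `1 - σ⁻¹`. -/
lemma tendsto_blockMean (hW : IsPlancherelWeight σ W e) (hσ : 1 ≤ σ) {φ : Word → ℝ}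
    (hφ : ∀ w, φ w ∈ Set.Icc (0 : ℝ) 1) {c : ℝ}
    (hc : Tendsto (fun n => wordMean W n φ) atTop (𝓝 c))
    (he : Tendsto (fun n => φ (e n)) atTop (𝓝 1)) {α : ℝ} (hα : α ∈ Set.Icc (0 : ℝ) 1) :
    Tendsto (fun n : ℕ => blockMean W n (α * n) φ) atTop
      (𝓝 (betaCDF σ α * (σ⁻¹ * c + 1 - σ⁻¹))) := by
  have hσ0 : 0 < σ := by linarith
  set θ := σ⁻¹ * c + 1 - σ⁻¹ with hθdef
  have hcI : c ∈ Set.Icc (0 : ℝ) 1 :=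
    isClosed_Icc.mem_of_tendsto hc (Eventually.of_forall fun n => wordMean_mem_Icc hW hσ hφ n)
  have hσi : σ⁻¹ ≤ 1 := inv_le_one_of_one_le₀ hσ
  have hθ : θ ∈ Set.Icc (0 : ℝ) 1 := by
    have := mul_nonneg (inv_nonneg.2 hσ0.le) hcI.1
    have := mul_le_mul_of_nonneg_left hcI.2 (inv_nonneg.2 hσ0.le)
    constructor <;> linarith
  have hlim : Tendsto (fun m => wordMean W m φ + (σ - 1) * φ (e m) - σ * θ) atTop (𝓝 0) := by
    have := (hc.add (he.const_mul (σ - 1))).sub_const (σ * θ)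
    convert this using 2
    rw [hθdef]
    field_simp
    ring
  have hdiff : Tendsto (fun n : ℕ => blockMean W n (α * n) φ -
      θ * blockMean W n (α * n) fun _ => 1) atTop (𝓝 0) := by
    rw [Metric.tendsto_atTop]
    intro ε hε
    obtain ⟨M, hM⟩ := Metric.tendsto_atTop.1 hlim (σ * (ε / 2)) (by positivity)
    have hpow : Tendsto (fun n : ℕ => (((max M 2 : ℕ) + σ + 1) / ((n : ℝ) + σ + 1)) ^ (σ / 2))
        atTop (𝓝 0) := by
      have h1 : Tendsto (fun n : ℕ => ((max M 2 : ℕ) + σ + 1) / ((n : ℝ) + σ + 1)) atTop (𝓝 0) :=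
        tendsto_const_nhds.div_atTop (tendsto_atTop_add_const_right _ _
          (tendsto_atTop_add_const_right _ _ tendsto_natCast_atTop_atTop))
      have := h1.rpow_const (p := σ / 2) (Or.inr (by positivity))
      rwa [Real.zero_rpow (by positivity)] at this
    obtain ⟨K, hK⟩ := Metric.tendsto_atTop.1 hpow (ε / 2) (by positivity)
    refine ⟨K, fun n hn => ?_⟩
    have h1 := abs_blockMean_sub_le hW hσ hφ hθ (half_pos hε).le (le_max_right M 2)
      (fun m hm => by
        have := hM m ((le_max_left _ _).trans hm)
        rw [Real.dist_0_eq_abs] at this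
        exact this.le) n (α * n)
    have h2 := hK n hn
    rw [Real.dist_0_eq_abs] at h2 ⊢
    linarith [le_abs_self ((((max M 2 : ℕ) + σ + 1) / ((n : ℝ) + σ + 1)) ^ (σ / 2))]
  have := hdiff.add ((tendsto_blockMean_one hW hσ hα).const_mul θ)
  simpa [mul_comm] using this

lemma xiCDF_zero (σ : ℝ) (α : ℕ → ℝ) : xiCDF σ 0 α = 1 := by simp [xiCDF]

/-- It holds from `n = 0` on because truncated subtraction and empty sums make `xiCDF σ 0` equal to
1. -/
lemma xiCDF_succ {σ : ℝ} (hσ : σ ≠ 0) (n : ℕ) (α : ℕ → ℝ) : xiCDF σ (n + 1) α =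
    betaCDF σ (α 0) * (σ⁻¹ * xiCDF σ n (fun i => α (i + 1)) + 1 - σ⁻¹) := by
  rcases n with _ | n
  · simp [xiCDF]
  · simp only [xiCDF, Nat.add_sub_cancel]
    rw [Finset.sum_Icc_succ_top (by omega), Finset.prod_range_succ', Nat.add_sub_cancel_left]
    have : ∑ j ∈ Finset.Icc 1 n, σ⁻¹ ^ (n + 1 + 1 - j) *
        ∏ i ∈ Finset.range (n + 1 + 1 - j), betaCDF σ (α i) =
        σ⁻¹ * betaCDF σ (α 0) * ∑ j ∈ Finset.Icc 1 n, σ⁻¹ ^ (n + 1 - j) *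
          ∏ i ∈ Finset.range (n + 1 - j), betaCDF σ (α (i + 1)) := by
      rw [Finset.mul_sum]
      refine Finset.sum_congr rfl fun j hj => ?_
      rw [Finset.mem_Icc] at hj
      obtain ⟨r, hr⟩ : ∃ r, n + 1 - j = r := ⟨_, rfl⟩
      have h2 : n + 1 + 1 - j = r + 1 := by omega
      rw [hr, h2, Finset.prod_range_succ', pow_succ]
      ring
    rw [this]
    simp only [Finset.range_one, Finset.prod_singleton, pow_succ]
    field_simp
    ring

lemma tendsto_normHike_exceptional (hW : IsPlancherelWeight σ W e) (j : ℕ) :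
    Tendsto (fun n => normHike (e n) j) atTop (𝓝 0) := by
  induction j with
  | zero =>
    refine (tendsto_inv_atTop_nhds_zero_nat (𝕜 := ℝ)).congr' ?_
    filter_upwards [eventually_ge_atTop 3] with n hn
    obtain ⟨m, rfl⟩ : ∃ m, n = m + 2 + 1 := ⟨n - 3, by omega⟩
    rw [normHike_zero, hW.weight_exc _ (by omega), hW.exc_succ _ (by omega),
      hTilde_one_cons_zero]
    simp
  | succ j ih =>
    refine (tendsto_add_atTop_iff_nat 1).1 (ih.congr' ?_)
    filter_upwards [eventually_ge_atTop 2] with n hn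
    rw [normHike_succ, hW.exc_succ n hn, tailWord]

open Classical in
lemma tendsto_wordMean_normHike (hW : IsPlancherelWeight σ W e) (hσ : 1 ≤ σ) (k : ℕ) (α : ℕ → ℝ)
    (hα : ∀ i < k, α i ∈ Set.Ioc (0 : ℝ) 1) :
    Tendsto (fun n => wordMean W n fun w => if ∀ i < k, normHike w i ≤ α i then 1 else 0) atTop
      (𝓝 (xiCDF σ k α)) := by
  induction k generalizing α with
  | zero => simp [xiCDF_zero, wordMean_const hW hσ]
  | succ k ih =>
    rw [xiCDF_succ (by linarith)]
    have hα' : ∀ i < k, α (i + 1) ∈ Set.Ioc (0 : ℝ) 1 := fun i hi => hα (i + 1) (by omega)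
    refine (tendsto_blockMean hW hσ ?_ (ih (fun i => α (i + 1)) hα') ?_
      (Set.Ioc_subset_Icc_self (hα 0 (by omega)))).congr' ?_
    · intro w
      split_ifs <;> simp
    · refine tendsto_const_nhds.congr' ?_
      -- The normalized hikes of `e n` tend to 0, so they fall below the thresholds because these
      -- are strictly positive.
      have : ∀ᶠ n in atTop, ∀ i ∈ Finset.range k, normHike (e n) i ≤ α (i + 1) := by
        rw [Finset.eventually_all]
        intro i hi
        rw [Finset.mem_range] at hi
        filter_upwards [(tendsto_normHike_exceptional hW i).eventually_lt_const (hα' i hi).1]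
          with n hn using hn.le
      filter_upwards [this] with n hn
      rw [if_pos]
      simpa using hn
    · filter_upwards [eventually_ge_atTop 1] with n hn
      refine wordMean_congr n fun w hw => ?_
      have hn0 : (0 : ℝ) < n := by positivity
      have h1 : (∀ i < k + 1, normHike w i ≤ α i) ↔ (hTilde w 0 : ℝ) ≤ α 0 * n ∧
          ∀ i < k, normHike (tailWord w) i ≤ α (i + 1) := by
        rw [Nat.forall_lt_succ_left', normHike_zero, hw, div_le_iff₀ hn0]
        simp only [normHike_succ]
      simp only [h1, ite_and]

end

/-! ### The limiting distribution -/

lemma one_div_beta_one {b : ℝ} (hb : 0 < b) : 1 / beta 1 b = b := by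
  rw [beta, Real.Gamma_one, one_mul, add_comm, Real.Gamma_add_one hb.ne']
  have := (Real.Gamma_pos_of_pos hb).ne'
  field_simp

lemma betaMeasure_one_Iic_of_nonpos (b : ℝ) {α : ℝ} (hα : α ≤ 0) :
    betaMeasure 1 b (Set.Iic α) = 0 := by
  rw [betaMeasure, withDensity_apply _ measurableSet_Iic]
  exact setLIntegral_eq_zero measurableSet_Iic fun x hx => betaPDF_eq_zero_of_nonpos (hx.trans hα)

lemma betaMeasure_one_Iic_one {b : ℝ} (hb : 0 < b) : betaMeasure 1 b (Set.Iic 1) = 1 := by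
  have := isProbabilityMeasureBeta one_pos hb
  rw [← prob_compl_eq_zero_iff measurableSet_Iic, Set.compl_Iic, betaMeasure,
    withDensity_apply _ measurableSet_Ioi]
  exact setLIntegral_eq_zero measurableSet_Ioi fun x hx => betaPDF_eq_zero_of_one_le hx.le

lemma betaMeasure_one_Iic {b : ℝ} (hb : 0 < b) {α : ℝ} (hα : α ∈ Set.Icc (0 : ℝ) 1) :
    betaMeasure 1 b (Set.Iic α) = ENNReal.ofReal (1 - (1 - α) ^ b) := by
  -- The density `b (1 - x)^(b - 1)` may be singular at 1, so the endpoint is treated separately.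
  rcases hα.2.eq_or_lt with rfl | h1
  · rw [betaMeasure_one_Iic_one hb]
    simp [Real.zero_rpow hb.ne']
  rw [← Set.Iic_union_Ioc_eq_Iic hα.1, measure_union (Set.Iic_disjoint_Ioc le_rfl)
    measurableSet_Ioc, betaMeasure_one_Iic_of_nonpos b le_rfl, zero_add, betaMeasure,
    withDensity_apply _ measurableSet_Ioc]
  have hpos : ∀ x ∈ Set.uIcc 0 α, 0 < 1 - x := fun x hx => by
    rw [Set.uIcc_of_le hα.1] at hx
    linarith [hx.2]
  have hcont : ContinuousOn (fun x : ℝ => b * (1 - x) ^ (b - 1)) (Set.uIcc 0 α) := by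
    refine continuousOn_const.mul (ContinuousOn.rpow_const (by fun_prop) fun x hx => ?_)
    exact Or.inl (hpos x hx).ne'
  have hint : IntervalIntegrable (fun x : ℝ => b * (1 - x) ^ (b - 1)) volume 0 α :=
    hcont.intervalIntegrable
  have h2 : ∫ x in (0 : ℝ)..α, b * (1 - x) ^ (b - 1) = 1 - (1 - α) ^ b := by
    rw [intervalIntegral.integral_eq_sub_of_hasDerivAt (f := fun x => -(1 - x) ^ b) _ hint]
    · simp
      ring
    · intro x hx
      have := ((hasDerivAt_id x).const_sub 1).rpow_const (p := b) (Or.inl (hpos x hx).ne')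
      refine this.neg.congr_deriv ?_
      simp
  rw [← h2, intervalIntegral.integral_of_le hα.1, ofReal_integral_eq_lintegral_ofReal]
  · refine setLIntegral_congr_fun measurableSet_Ioc fun x hx => ?_
    rw [betaPDF_of_pos_lt_one hx.1 (hx.2.trans_lt h1), one_div_beta_one hb]
    simp
  · exact (intervalIntegrable_iff_integrableOn_Ioc_of_le hα.1).1 hint
  · refine (ae_restrict_iff' measurableSet_Ioc).2 (Eventually.of_forall fun x hx => ?_)
    have := hpos x (by rw [Set.uIcc_of_le hα.1]; exact Set.Ioc_subset_Icc_self hx)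
    simp only [Pi.zero_apply]
    positivity

lemma betaCDF_mem_Icc {σ : ℝ} (hσ : 0 ≤ σ) {α : ℝ} (hα : α ∈ Set.Icc (0 : ℝ) 1) :
    betaCDF σ α ∈ Set.Icc (0 : ℝ) 1 := by
  have h1 : 0 ≤ 1 - α := by linarith [hα.2]
  have h2 := Real.rpow_nonneg h1 (σ / 2)
  have h3 := Real.rpow_le_one h1 (by linarith [hα.1]) (by positivity : 0 ≤ σ / 2)
  rw [betaCDF]
  constructor <;> linarith

section

variable {Ω : Type*} [MeasurableSpace Ω] {P : Measure Ω}

lemma IsIIDBeta.measure_le {b : ℝ} {U : ℕ → Ω → ℝ} (h : IsIIDBeta b P U) (hb : 0 < b) (k : ℕ)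
    {α : ℝ} (hα : α ∈ Set.Icc (0 : ℝ) 1) :
    P (U k ⁻¹' Set.Iic α) = ENNReal.ofReal (1 - (1 - α) ^ b) := by
  rw [← Measure.map_apply (h.measurable k) measurableSet_Iic, h.law, betaMeasure_one_Iic hb hα]

lemma IsIIDBeta.ae_mem_Icc {b : ℝ} {U : ℕ → Ω → ℝ} (h : IsIIDBeta b P U) (hb : 0 < b) (k : ℕ) :
    ∀ᵐ ω ∂P, U k ω ∈ Set.Icc (0 : ℝ) 1 := by
  have := isProbabilityMeasureBeta one_pos hb
  have h0 : ∀ᵐ x ∂(betaMeasure 1 b), x ∈ Set.Icc (0 : ℝ) 1 := by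
    have h1 : ∀ᵐ x ∂(betaMeasure 1 b), x ∈ Set.Iic (1 : ℝ) :=
      (prob_compl_eq_zero_iff measurableSet_Iic).2 (betaMeasure_one_Iic_one hb)
    have h2 : ∀ᵐ x ∂(betaMeasure 1 b), x ∉ Set.Iic (0 : ℝ) :=
      measure_eq_zero_iff_ae_notMem.1 (betaMeasure_one_Iic_of_nonpos b le_rfl)
    filter_upwards [h1, h2] with x hx1 hx2
    exact ⟨(not_le.1 hx2).le, hx1⟩
  rw [← h.law k] at h0
  exact ae_of_ae_map (h.measurable k).aemeasurable h0

lemma IsIIDBeta.measureReal_forall_le {σ : ℝ} (hσ : 0 < σ) {U : ℕ → Ω → ℝ}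
    (h : IsIIDBeta (σ / 2) P U) {n : ℕ} {α : ℕ → ℝ}
    (hα : ∀ i < n, α i ∈ Set.Icc (0 : ℝ) 1) :
    P.real {ω | ∀ i < n, U i ω ≤ α i} = ∏ i ∈ Finset.range n, betaCDF σ (α i) := by
  have h1 : {ω | ∀ i < n, U i ω ≤ α i} = ⋂ i ∈ Finset.range n, U i ⁻¹' Set.Iic (α i) := by
    ext
    simp
  rw [h1, Measure.real, (iIndepFun_iff_measure_inter_preimage_eq_mul.1 h.indep) (Finset.range n)
    (fun i _ => measurableSet_Iic), ENNReal.toReal_prod]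
  refine Finset.prod_congr rfl fun i hi => ?_
  have hi' := hα i (Finset.mem_range.1 hi)
  rw [h.measure_le (by positivity) i hi', ← betaCDF,
    ENNReal.toReal_ofReal (betaCDF_mem_Icc hσ.le hi').1]

/-- In the coin model the subtracted term is the probability that the first `n + 1` coins succeed,
the first `n` beta variables obey their bounds and the next one does not. -/
lemma xiCDF_succ_eq_sub {σ : ℝ} (hσ : σ ≠ 0) (n : ℕ) (α : ℕ → ℝ) :
    xiCDF σ (n + 1) α = xiCDF σ n α -
      σ⁻¹ ^ n * (∏ i ∈ Finset.range n, betaCDF σ (α i) -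
        ∏ i ∈ Finset.range (n + 1), betaCDF σ (α i)) := by
  induction n generalizing α with
  | zero => simp [xiCDF]
  | succ n ih =>
    rw [xiCDF_succ hσ, ih, xiCDF_succ hσ n,
      Finset.prod_range_succ' (fun i => betaCDF σ (α i)) (n + 1),
      Finset.prod_range_succ' (fun i => betaCDF σ (α i)) n, pow_succ]
    ring

/-! ### The construction from coins -/

lemma natCast_lt_successes_iff (c : ℕ → Bool) (k : ℕ) :
    (k : ℕ∞) < successes c ↔ ∀ j < k + 1, c j = true := by
  rw [successes]
  constructor
  · intro h j hj
    by_contra hc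
    have := h.trans_le (iInf₂_le j (by simpa using hc))
    rw [Nat.cast_lt] at this
    omega
  · intro h
    refine lt_of_lt_of_le (b := ((k + 1 : ℕ) : ℕ∞)) (by exact_mod_cast Nat.lt_succ_self k) ?_
    refine le_iInf₂ fun j hj => ?_
    rw [Nat.cast_le]
    by_contra hlt
    rw [h j (by omega)] at hj
    simp at hj

lemma IsCoinSequence.measureReal_forall {σ : ℝ} {c : ℕ → Ω → Bool} (h : IsCoinSequence σ P c)
    (n : ℕ) : P.real {ω | ∀ j < n + 1, c j ω = true} = σ⁻¹ ^ n := by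
  have h1 : {ω | ∀ j < n + 1, c j ω = true} =
      ⋂ j ∈ Finset.range (n + 1), c j ⁻¹' {true} := by
    ext
    simp
  rw [h1, Measure.real, (iIndepFun_iff_measure_inter_preimage_eq_mul.1 h.indep)
    (Finset.range (n + 1)) (fun i _ => measurableSet_singleton _), ENNReal.toReal_prod,
    Finset.prod_range_succ']
  have h2 : ∀ j, (P (c (j + 1) ⁻¹' {true})).toReal = σ⁻¹ := h.prob_succ
  have h3 : (P (c 0 ⁻¹' {true})).toReal = 1 := h.prob_zero
  simp [h2, h3]

lemma isXiSequence_truncateAt {σ : ℝ} (hσ : 0 < σ) [IsProbabilityMeasure P] {c : ℕ → Ω → Bool}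
    {U : ℕ → Ω → ℝ} (hc : IsCoinSequence σ P c) (hU : IsIIDBeta (σ / 2) P U)
    (hind : IndepFun (fun ω k => c k ω) (fun ω k => U k ω) P) :
    IsXiSequence σ P fun k ω => truncateAt (successes fun j => c j ω) (fun i => U i ω) k := by
  classical
  have htr : ∀ k ω, truncateAt (successes fun j => c j ω) (fun i => U i ω) k =
      if ∀ j < k + 1, c j ω = true then U k ω else 0 := fun k ω => by
    simp only [truncateAt, natCast_lt_successes_iff]
  have hS : ∀ n, MeasurableSet {ω | ∀ j < n, c j ω = true} := fun n => by
    have : {ω | ∀ j < n, c j ω = true} = ⋂ j, ⋂ (_ : j < n), c j ⁻¹' {true} := by ext; simp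
    rw [this]
    exact .iInter fun j => .iInter fun _ => hc.measurable j (measurableSet_singleton _)
  have hV : ∀ n (α : ℕ → ℝ), MeasurableSet {ω | ∀ j < n, U j ω ≤ α j} := fun n α => by
    have : {ω | ∀ j < n, U j ω ≤ α j} = ⋂ j, ⋂ (_ : j < n), U j ⁻¹' Set.Iic (α j) := by
      ext; simp
    rw [this]
    exact .iInter fun j => .iInter fun _ => hU.measurable j measurableSet_Iic
  have hSV : ∀ m n (α : ℕ → ℝ), P.real ({ω | ∀ j < m, c j ω = true} ∩
      {ω | ∀ j < n, U j ω ≤ α j}) =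
      P.real {ω | ∀ j < m, c j ω = true} * P.real {ω | ∀ j < n, U j ω ≤ α j} := by
    intro m n α
    have h1 : MeasurableSet {x : ℕ → Bool | ∀ j < m, x j = true} := by
      have : {x : ℕ → Bool | ∀ j < m, x j = true} =
        ⋂ j, ⋂ (_ : j < m), (fun x => x j) ⁻¹' {true} := by ext; simp
      rw [this]
      exact .iInter fun j => .iInter fun _ => measurable_pi_apply j (measurableSet_singleton _)
    have h2 : MeasurableSet {x : ℕ → ℝ | ∀ j < n, x j ≤ α j} := by
      have : {x : ℕ → ℝ | ∀ j < n, x j ≤ α j} =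
        ⋂ j, ⋂ (_ : j < n), (fun x => x j) ⁻¹' Set.Iic (α j) := by ext; simp
      rw [this]
      exact .iInter fun j => .iInter fun _ => measurable_pi_apply j measurableSet_Iic
    have := hind.measure_inter_preimage_eq_mul _ _ h1 h2
    simp only [Measure.real, ← ENNReal.toReal_mul]
    exact congrArg ENNReal.toReal this
  have hmeas : ∀ k, Measurable fun ω =>
      truncateAt (successes fun j => c j ω) (fun i => U i ω) k := by
    intro k
    simp only [htr]
    exact Measurable.ite (hS (k + 1)) (hU.measurable k) measurable_const
  refine ⟨hmeas, ?_, ?_⟩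
  · intro k
    filter_upwards [hU.ae_mem_Icc (by positivity) k] with ω hω
    rw [htr]
    split_ifs
    · exact hω
    · simp
  · intro n _ α hα
    clear * - htr hS hV hSV hα hc hU hσ hmeas
    induction n with
    | zero => simp [xiCDF_zero]
    | succ n ih =>
      -- If one of the first `n + 1` coins fails, the new coordinate is 0 and its bound holds
      -- automatically. Hence passing from `n` to `n + 1` removes exactly the difference of these
      -- two events.
      have hsub : {ω | ∀ j < n + 1, c j ω = true} ∩ {ω | ∀ j < n + 1, U j ω ≤ α j} ⊆
          {ω | ∀ j < n + 1, c j ω = true} ∩ {ω | ∀ j < n, U j ω ≤ α j} :=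
        fun ω hω => ⟨hω.1, fun i hi => hω.2 i (by omega)⟩
      rw [xiCDF_succ_eq_sub hσ.ne', ← ih fun i hi => hα i (by omega),
        ← hU.measureReal_forall_le hσ hα, ← hU.measureReal_forall_le hσ fun i hi =>
          hα i (by omega : i < n + 1), ← hc.measureReal_forall, mul_sub, ← hSV, ← hSV,
        ← measureReal_sdiff hsub ((hS _).inter (hV _ _)), ← measureReal_sdiff ?_ ?_]
      · congr 1
        ext ω
        simp only [htr, Set.mem_sdiff, Set.mem_inter_iff, Set.mem_ofPred_eq]
        constructor
        · intro h
          refine ⟨fun i hi => h i (by omega), fun ⟨⟨h1, h2⟩, h3⟩ => h3 ⟨h1, fun i hi => ?_⟩⟩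
          have := h i hi
          rwa [if_pos fun j hj => h1 j (by omega)] at this
        · rintro ⟨h1, h2⟩ i hi
          rcases Nat.lt_succ_iff_lt_or_eq.1 hi with hi | rfl
          · exact h1 i hi
          split_ifs with h3
          · by_contra h4
            refine h2 ⟨⟨h3, fun j hj => ?_⟩, fun h5 => h4 (h5.2 i hi)⟩
            have := h1 j hj
            rwa [if_pos fun l hl => h3 l (by omega)] at this
          · exact (hα i hi).1
      · rintro ω ⟨⟨h1, h2⟩, -⟩ i hi
        rw [htr, if_pos fun j hj => h1 j (by omega)]
        exact h2 i hi
      · exact ((hS _).inter (hV _ _)).diff ((hS _).inter (hV _ _))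

/-! ### Uniqueness of the limiting law -/

lemma IsXiSequence.map {σ : ℝ} {ξ : ℕ → Ω → ℝ} (h : IsXiSequence σ P ξ) :
    IsXiSequence σ (P.map fun ω k => ξ k ω) fun k u => u k := by
  have hm : Measurable fun ω k => ξ k ω := measurable_pi_lambda _ h.measurable
  refine ⟨fun k => measurable_pi_apply k, fun k => ?_, fun n hn α hα => ?_⟩
  · rw [ae_map_iff hm.aemeasurable]
    · exact h.mem_Icc k
    · exact measurable_pi_apply k measurableSet_Icc
  · rw [map_measureReal_apply hm]
    · exact h.cdf n hn α hα
    · have : {u : ℕ → ℝ | ∀ i < n, u i ≤ α i} =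
        ⋂ j, ⋂ (_ : j < n), (fun x => x j) ⁻¹' Set.Iic (α j) := by ext; simp
      rw [this]
      exact .iInter fun j => .iInter fun _ => measurable_pi_apply j measurableSet_Iic

/-- The joint distribution function outside the unit cube. -/
lemma IsXiSequence.measureReal_forall_le [IsProbabilityMeasure P] {σ : ℝ} {ξ : ℕ → Ω → ℝ}
    (h : IsXiSequence σ P ξ) (n : ℕ) (α : ℕ → ℝ) :
    P.real {ω | ∀ i < n, ξ i ω ≤ α i} =
      open Classical in if ∀ i < n, 0 ≤ α i then xiCDF σ n (fun i => min (α i) 1) else 0 := by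
  split_ifs with h0
  · have h1 : P.real {ω | ∀ i < n, ξ i ω ≤ α i} = P.real {ω | ∀ i < n, ξ i ω ≤ min (α i) 1} := by
      refine measureReal_congr ?_
      filter_upwards [ae_all_iff.2 h.mem_Icc] with ω hω
      refine propext (forall₂_congr fun i _ => ?_)
      rw [le_min_iff]
      exact ⟨fun h => ⟨h, (hω i).2⟩, fun h => h.1⟩
    rw [h1]
    rcases Nat.eq_zero_or_pos n with rfl | hn
    · simp [xiCDF_zero]
    · exact h.cdf n hn _ fun i hi => ⟨le_min (h0 i hi) zero_le_one, min_le_right _ _⟩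
  · push Not at h0
    obtain ⟨i, hi, h0⟩ := h0
    refine (measureReal_eq_zero_iff (by finiteness)).2 (measure_eq_zero_iff_ae_notMem.2 ?_)
    filter_upwards [h.mem_Icc i] with ω hω hω'
    linarith [hω.1, hω' i hi]

/-- The half-infinite boxes in the space of sequences form a generating π-system. -/
lemma isPiSystem_forall_le :
    IsPiSystem {s : Set (ℕ → ℝ) | ∃ (n : ℕ) (α : ℕ → ℝ), s = {u | ∀ i < n, u i ≤ α i}} := by
  rintro _ ⟨n, α, rfl⟩ _ ⟨m, β, rfl⟩ -
  refine ⟨max n m, fun i => if i < n then if i < m then min (α i) (β i) else α i else β i, ?_⟩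
  ext u
  simp only [Set.mem_inter_iff, Set.mem_ofPred_eq, lt_max_iff]
  constructor
  · rintro ⟨h1, h2⟩ i hi
    split_ifs with hn hm
    · exact le_min (h1 i hn) (h2 i hm)
    · exact h1 i hn
    · exact h2 i (hi.resolve_left hn)
  · intro h
    refine ⟨fun i hi => ?_, fun i hi => ?_⟩
    · have := h i (Or.inl hi)
      rw [if_pos hi] at this
      split_ifs at this
      · exact this.trans (min_le_left _ _)
      · exact this
    · have := h i (Or.inr hi)
      rw [if_pos hi] at this
      split_ifs at this
      · exact this.trans (min_le_right _ _)
      · exact this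

lemma generateFrom_forall_le : (MeasurableSpace.pi : MeasurableSpace (ℕ → ℝ)) =
    MeasurableSpace.generateFrom {s | ∃ (n : ℕ) (α : ℕ → ℝ), s = {u | ∀ i < n, u i ≤ α i}} := by
  refine le_antisymm (iSup_le fun k => ?_) (MeasurableSpace.generateFrom_le ?_)
  · rw [BorelSpace.measurable_eq (α := ℝ), borel_eq_generateFrom_Iic,
      MeasurableSpace.comap_generateFrom]
    refine MeasurableSpace.generateFrom_le ?_
    rintro _ ⟨_, ⟨a, rfl⟩, rfl⟩
    -- A bound on one coordinate is an increasing union of boxes whose other bounds `N` grow to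
    -- infinity.
    have : (fun u : ℕ → ℝ => u k) ⁻¹' Set.Iic a =
        ⋃ N : ℕ, {u | ∀ i < k + 1, u i ≤ if i = k then a else N} := by
      ext u
      simp only [Set.mem_preimage, Set.mem_Iic, Set.mem_iUnion, Set.mem_ofPred_eq]
      constructor
      · intro h
        obtain ⟨N, hN⟩ := exists_nat_ge (∑ i ∈ Finset.range k, |u i|)
        refine ⟨N, fun i hi => ?_⟩
        split_ifs with hk
        · rwa [hk]
        · refine (le_abs_self _).trans (le_trans ?_ hN)
          exact Finset.single_le_sum (f := fun i => |u i|) (fun _ _ => abs_nonneg _)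
            (Finset.mem_range.2 (by omega))
      · rintro ⟨N, hN⟩
        simpa using hN k (by omega)
    rw [this]
    exact MeasurableSet.iUnion fun N => MeasurableSpace.measurableSet_generateFrom ⟨_, _, rfl⟩
  · rintro _ ⟨n, α, rfl⟩
    have : {u : ℕ → ℝ | ∀ i < n, u i ≤ α i} =
      ⋂ j, ⋂ (_ : j < n), (fun x => x j) ⁻¹' Set.Iic (α j) := by ext; simp
    rw [this]
    exact .iInter fun j => .iInter fun _ => measurable_pi_apply j measurableSet_Iic

lemma IsXiSequence.unique {σ : ℝ} {μ ν : Measure (ℕ → ℝ)} [IsProbabilityMeasure μ]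
    [IsProbabilityMeasure ν] (hμ : IsXiSequence σ μ fun k u => u k)
    (hν : IsXiSequence σ ν fun k u => u k) : μ = ν := by
  refine ext_of_generate_finite _ generateFrom_forall_le isPiSystem_forall_le ?_ (by simp)
  rintro _ ⟨n, α, rfl⟩
  rw [← measureReal_eq_measureReal_iff, hμ.measureReal_forall_le, hν.measureReal_forall_le]

/-! ### Existence and dependence of the limiting variables -/

lemma iIndepFun_eval_comp {α : Type*} [MeasurableSpace α] {ν : ℕ → Measure α}
    [∀ i, IsProbabilityMeasure (ν i)] [IsProbabilityMeasure P] {X : ℕ → Ω → α}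
    (hX : ∀ i, Measurable (X i)) (h : P.map (fun ω i => X i ω) = Measure.infinitePi ν) :
    (∀ i, P.map (X i) = ν i) ∧ iIndepFun X P := by
  have h1 : ∀ i, P.map (X i) = ν i := fun i => by
    rw [← (measurePreserving_eval_infinitePi ν i).map_eq, ← h,
      Measure.map_map (measurable_pi_apply i) (measurable_pi_lambda _ hX)]
    rfl
  refine ⟨h1, ?_⟩
  rw [iIndepFun_iff_map_fun_eq_infinitePi_map hX, h]
  simp only [h1]

/-- Coins and independent beta random variables exist. -/
lemma exists_coins_and_betas {σ : ℝ} (hσ : 1 ≤ σ) :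
    ∃ (P : Measure ((ℕ → Bool) × (ℕ → ℝ))), IsProbabilityMeasure P ∧
      IsCoinSequence σ P (fun k ω => ω.1 k) ∧ IsIIDBeta (σ / 2) P (fun k ω => ω.2 k) ∧
      IndepFun (fun ω k => ω.1 k) (fun ω k => ω.2 k) P := by
  have hσi : σ⁻¹ ≤ 1 := inv_le_one_of_one_le₀ hσ
  have hσ0 : 0 ≤ σ⁻¹ := by positivity
  have := isProbabilityMeasureBeta one_pos (by positivity : 0 < σ / 2)
  let p : ℕ → ℝ := fun k => if k = 0 then 1 else σ⁻¹
  let ν : ℕ → Measure Bool := fun k =>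
    ENNReal.ofReal (p k) • Measure.dirac true + ENNReal.ofReal (1 - p k) • Measure.dirac false
  have hp : ∀ k, p k ∈ Set.Icc (0 : ℝ) 1 := fun k => by
    by_cases h : k = 0
    · simp [p, h]
    · simp [p, h, hσ0, hσi]
  have hν : ∀ k, IsProbabilityMeasure (ν k) := fun k => ⟨by
    simp [ν, ← ENNReal.ofReal_add (hp k).1 (sub_nonneg.2 (hp k).2)]⟩
  have hνt : ∀ k, (ν k).real {true} = p k := fun k => by
    simp [ν, Measure.real, ENNReal.toReal_ofReal (hp k).1]
  let P := (Measure.infinitePi ν).prod (Measure.infinitePi fun _ : ℕ => betaMeasure 1 (σ / 2))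
  have h1 := iIndepFun_eval_comp (P := P) (ν := ν) (X := fun k ω => ω.1 k) (by fun_prop)
    (by simp [P])
  have h2 := iIndepFun_eval_comp (P := P) (ν := fun _ => betaMeasure 1 (σ / 2))
    (X := fun k ω => ω.2 k) (by fun_prop)
    (by simp [P])
  have h3 : ∀ k, P.real {ω | ω.1 k = true} = p k := fun k => by
    rw [← hνt, ← h1.1 k, map_measureReal_apply (by fun_prop) (measurableSet_singleton _)]
    rfl
  refine ⟨P, inferInstance, ⟨by fun_prop, by simp [h3, p], by simp [h3, p], h1.2⟩,
    ⟨by fun_prop, h2.1, h2.2⟩, ?_⟩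
  exact indepFun_prod (X := id) (Y := id) measurable_id measurable_id

lemma existsUnique_isXiSequence {σ : ℝ} (hσ : 1 ≤ σ) :
    ∃! μ : Measure (ℕ → ℝ), IsProbabilityMeasure μ ∧ IsXiSequence σ μ fun k u => u k := by
  obtain ⟨P, hP, hc, hU, hind⟩ := exists_coins_and_betas hσ
  have h := isXiSequence_truncateAt (by linarith) hc hU hind
  refine ⟨_, ⟨?_, h.map⟩, ?_⟩
  · exact Measure.isProbabilityMeasure_map (measurable_pi_lambda _ h.measurable).aemeasurable
  · rintro μ ⟨hμ, hμ'⟩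
    have := Measure.isProbabilityMeasure_map (μ := P)
      (measurable_pi_lambda _ h.measurable).aemeasurable
    exact hμ'.unique h.map

lemma isXiSequence_of_isIIDBeta {U : ℕ → Ω → ℝ} (hU : IsIIDBeta (1 / 2) P U) :
    IsXiSequence 1 P U := by
  refine ⟨hU.measurable, hU.ae_mem_Icc (by norm_num), fun n _ α hα => ?_⟩
  rw [hU.measureReal_forall_le one_pos hα]
  simp [xiCDF]

lemma forall_lt_two_iff {p : ℕ → Prop} : (∀ i < 2, p i) ↔ p 0 ∧ p 1 :=
  ⟨fun h => ⟨h 0 (by omega), h 1 (by omega)⟩, fun h i hi => by interval_cases i <;> tauto⟩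

lemma forall_lt_three_iff {p : ℕ → Prop} : (∀ i < 3, p i) ↔ p 0 ∧ p 1 ∧ p 2 :=
  ⟨fun h => ⟨h 0 (by omega), h 1 (by omega), h 2 (by omega)⟩,
    fun h i hi => by interval_cases i <;> tauto⟩

/-- Zero is absorbing: the second and third variables vanish with probabilities `1 - σ⁻¹` and `1 -
σ⁻²`, but jointly with probability `1 - σ⁻¹`, which is not the product when `σ > 1`. -/
lemma IsXiSequence.not_iIndepFun {σ : ℝ} (hσ : 1 < σ) [IsProbabilityMeasure P]
    {ξ : ℕ → Ω → ℝ} (h : IsXiSequence σ P ξ) : ¬ iIndepFun ξ P := by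
  intro hind
  have hσ0 : σ ≠ 0 := by linarith
  have hb0 : betaCDF σ 0 = 0 := by simp [betaCDF]
  have hb1 : betaCDF σ 1 = 1 := by
    simp [betaCDF, Real.zero_rpow (by positivity : σ / 2 ≠ 0)]
  have h1 : P.real (ξ 1 ⁻¹' Set.Iic 0) = 1 - σ⁻¹ := by
    have := h.measureReal_forall_le 2 fun i => if i = 0 then 1 else 0
    rw [if_pos (by intro i _; split_ifs <;> simp)] at this
    have h2 : xiCDF σ 2 (fun i => min (if i = 0 then 1 else 0) 1) = 1 - σ⁻¹ := by
      simp [xiCDF_succ hσ0, xiCDF_zero, hb0, hb1]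
    rw [← h2, ← this]
    refine measureReal_congr ?_
    filter_upwards [ae_all_iff.2 h.mem_Icc] with ω hω
    refine propext ?_
    change ξ 1 ω ≤ 0 ↔ ∀ i < 2, ξ i ω ≤ if i = 0 then 1 else 0
    rw [forall_lt_two_iff]
    simpa using fun _ => (hω 0).2
  have h2 : P.real (ξ 2 ⁻¹' Set.Iic 0) = 1 - σ⁻¹ * σ⁻¹ := by
    have := h.measureReal_forall_le 3 fun i => if i < 2 then 1 else 0
    rw [if_pos (by intro i _; split_ifs <;> simp)] at this
    have h2 : xiCDF σ 3 (fun i => min (if i < 2 then 1 else 0) 1) = 1 - σ⁻¹ * σ⁻¹ := by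
      simp [xiCDF_succ hσ0, xiCDF_zero, hb0, hb1]
      ring
    rw [← h2, ← this]
    refine measureReal_congr ?_
    filter_upwards [ae_all_iff.2 h.mem_Icc] with ω hω
    refine propext ?_
    change ξ 2 ω ≤ 0 ↔ ∀ i < 3, ξ i ω ≤ if i < 2 then 1 else 0
    rw [forall_lt_three_iff]
    simp [(hω 0).2, (hω 1).2]
  have h3 : P.real (ξ 1 ⁻¹' Set.Iic 0 ∩ ξ 2 ⁻¹' Set.Iic 0) = 1 - σ⁻¹ := by
    have := h.measureReal_forall_le 3 fun i => if i = 0 then 1 else 0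
    rw [if_pos (by intro i _; split_ifs <;> simp)] at this
    have h2 : xiCDF σ 3 (fun i => min (if i = 0 then 1 else 0) 1) = 1 - σ⁻¹ := by
      simp [xiCDF_succ hσ0, xiCDF_zero, hb0, hb1]
    rw [← h2, ← this]
    refine measureReal_congr ?_
    filter_upwards [ae_all_iff.2 h.mem_Icc] with ω hω
    refine propext ?_
    change (ξ 1 ω ≤ 0 ∧ ξ 2 ω ≤ 0) ↔ ∀ i < 3, ξ i ω ≤ if i = 0 then 1 else 0
    rw [forall_lt_three_iff]
    simpa using fun _ _ => (hω 0).2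
  have h4 := (hind.indepFun (by norm_num : (1 : ℕ) ≠ 2)).measure_inter_preimage_eq_mul
    _ _ (measurableSet_Iic (a := (0 : ℝ))) (measurableSet_Iic (a := (0 : ℝ)))
  have h5 := congrArg ENNReal.toReal h4
  rw [ENNReal.toReal_mul] at h5
  change P.real _ = P.real _ * P.real _ at h5
  rw [h1, h2, h3] at h5
  have h6 : 0 < σ⁻¹ := by positivity
  have h7 : σ⁻¹ < 1 := inv_lt_one_of_one_lt₀ hσ
  have h8 : 0 < (1 - σ⁻¹) * (σ⁻¹ * σ⁻¹) := mul_pos (by linarith) (mul_pos h6 h6)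
  linarith

end

/-! ### The coherent measures as measures -/

/-- The first letter splits the words of weight `n + 2` into those of weights `n + 1` and `n`, as in
the definition of `wordSum`. -/
lemma tsum_ofReal_weight_eq (n : ℕ) {g : Word → ℝ} (hg : ∀ w, 0 ≤ g w) :
    ∑' w : {w : Word // weight w = n}, ENNReal.ofReal (g w.1) = ENNReal.ofReal (wordSum n g) := by
  induction n using Nat.twoStepInduction generalizing g with
  | zero =>
    rw [tsum_eq_single (⟨[], rfl⟩ : {w : Word // weight w = 0})]
    · rfl
    · rintro ⟨_ | ⟨_ | _, v⟩, hw⟩ h <;> simp at hw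
      exact absurd rfl h
  | one =>
    rw [tsum_eq_single (⟨[Letter.one], rfl⟩ : {w : Word // weight w = 1})]
    · rfl
    · rintro ⟨_ | ⟨_ | _, _ | ⟨_ | _, v⟩⟩, hw⟩ h <;> simp at hw
      exact absurd rfl h
  | more n h0 h1 =>
    let f : {w : Word // weight w = n + 1} ⊕ {w : Word // weight w = n} →
        {w : Word // weight w = n + 2} := Sum.elim
      (fun w => ⟨Letter.one :: w.1, by simp [w.2]⟩) (fun w => ⟨Letter.two :: w.1, by simp [w.2]⟩)
    have hf : Function.Bijective f := by
      constructor
      · rintro (⟨v, hv⟩ | ⟨v, hv⟩) (⟨w, hw⟩ | ⟨w, hw⟩) h <;>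
          simpa [f, Subtype.ext_iff] using congrArg Subtype.val h
      · rintro ⟨_ | ⟨_ | _, v⟩, hw⟩
        · simp at hw
        · exact ⟨Sum.inl ⟨v, by simpa using hw⟩, rfl⟩
        · exact ⟨Sum.inr ⟨v, by simpa using hw⟩, rfl⟩
    have hnn : ∀ (m : ℕ) (g : Word → ℝ), (∀ w, 0 ≤ g w) → 0 ≤ wordSum m g := fun m g hg =>
      (wordSum_zero m).ge.trans (wordSum_le m fun w _ => hg w)
    rw [wordSum, ENNReal.ofReal_add (hnn _ _ fun w => hg _) (hnn _ _ fun w => hg _),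
      ← h1 fun w => hg _, ← h0 fun w => hg _, ← (Equiv.ofBijective f hf).tsum_eq]
    exact (HasSum.sum (f := fun w => ENNReal.ofReal (g ((Equiv.ofBijective f hf) w).1))
      ENNReal.summable.hasSum ENNReal.summable.hasSum).tsum_eq

lemma measurableSet_YF {n : ℕ} (s : Set (YF n)) : MeasurableSet s := trivial

lemma measurable_YF {n : ℕ} {β : Type*} [MeasurableSpace β] (f : YF n → β) : Measurable f :=
  fun _ _ => measurableSet_YF _

open Classical in
lemma cloneMeasure_apply {x y : ℕ → ℝ} (h : ∀ w, 0 ≤ cloneWeight x y w) (n : ℕ)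
    (p : Word → Prop) : cloneMeasure x y n {w | p w.1} =
      ENNReal.ofReal (wordMean (cloneWeight x y) n fun w => if p w then 1 else 0) := by
  have h1 : ∀ w, 0 ≤ cloneWeight x y w * if p w then 1 else 0 := fun w => by
    have := h w
    positivity
  rw [cloneMeasure, Measure.sum_apply _ (measurableSet_YF _), wordMean,
    ← tsum_ofReal_weight_eq n h1]
  refine tsum_congr fun w => ?_
  rw [Measure.smul_apply, Measure.dirac_apply' _ (measurableSet_YF _), smul_eq_mul]
  by_cases hp : p w.1 <;> simp [Set.indicator, hp]

section

variable {σ x₁ : ℝ}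

lemma isProbabilityMeasure_cloneMeasure (hσ : 1 ≤ σ) (hx : x₁ = 1 ∨ x₁ = σ) (n : ℕ) :
    IsProbabilityMeasure (cloneMeasure (plancherelX σ x₁) (plancherelY σ) n) := by
  obtain ⟨e, hW⟩ := exists_isPlancherelWeight hσ hx
  refine ⟨?_⟩
  have := cloneMeasure_apply hW.nonneg n fun _ => True
  simpa [wordMean_const hW hσ] using this

/-! ### Weak convergence -/

/-- Convergence of the joint distribution functions away from the coordinate hyperplanes implies
weak convergence. -/
lemma tendsto_probabilityMeasure_of_forall_le {k : ℕ} {μ : ℕ → ProbabilityMeasure (Fin k → ℝ)}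
    {ν : ProbabilityMeasure (Fin k → ℝ)}
    (h : ∀ b : Fin k → ℝ, (∀ j, b j ≠ 0) → Tendsto (fun n =>
      (μ n : Measure (Fin k → ℝ)).real {x | ∀ j, x j ≤ b j}) atTop
        (𝓝 ((ν : Measure (Fin k → ℝ)).real {x | ∀ j, x j ≤ b j}))) :
    Tendsto μ atTop (𝓝 ν) := by
  -- The set `A` records the coordinates that carry a lower bound. Adding one is a difference of
  -- nested boxes, with `min (a i) (b i)` as the new upper bound so that nesting holds even if `b i
  -- < a i`.
  let box (A : Finset (Fin k)) (a b : Fin k → ℝ) : Set (Fin k → ℝ) :=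
    {x | ∀ j, x j ≤ b j ∧ (j ∈ A → a j < x j)}
  have hmeas : ∀ A a b, MeasurableSet (box A a b) := by
    intro A a b
    have : box A a b = ⋂ j, ((fun x => x j) ⁻¹' Set.Iic (b j) ∩
        ⋂ (_ : j ∈ A), (fun x => x j) ⁻¹' Set.Ioi (a j)) := by
      ext
      simp [box]
    rw [this]
    exact .iInter fun j => (measurable_pi_apply j measurableSet_Iic).inter
      (.iInter fun _ => measurable_pi_apply j measurableSet_Ioi)
  have hbox : ∀ A a b, (∀ j, a j ≠ 0) → (∀ j, b j ≠ 0) → Tendsto (fun n =>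
      (μ n : Measure (Fin k → ℝ)).real (box A a b)) atTop
        (𝓝 ((ν : Measure (Fin k → ℝ)).real (box A a b))) := by
    intro A a b ha hb
    induction A using Finset.induction_on generalizing b with
    | empty => simpa [box] using h b hb
    | insert i A hi ih =>
      have h1 : ∀ j, Function.update b i (min (a i) (b i)) j ≠ 0 := by
        intro j
        rcases eq_or_ne j i with rfl | hj
        · rw [Function.update_self]
          rcases min_choice (a j) (b j) with h | h <;> rw [h]
          exacts [ha j, hb j]
        · rw [Function.update_of_ne hj]
          exact hb j
      have hsub : box A a (Function.update b i (min (a i) (b i))) ⊆ box A a b := by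
        intro x hx j
        refine ⟨(hx j).1.trans ?_, (hx j).2⟩
        rcases eq_or_ne j i with rfl | hj
        · rw [Function.update_self]
          exact min_le_right _ _
        · rw [Function.update_of_ne hj]
      have heq : box (insert i A) a b =
          box A a b \ box A a (Function.update b i (min (a i) (b i))) := by
        ext x
        constructor
        · intro hx
          refine ⟨fun j => ⟨(hx j).1, fun hj => (hx j).2 (Finset.mem_insert_of_mem hj)⟩,
            fun hx' => ?_⟩
          have h2 := (hx' i).1
          rw [Function.update_self] at h2
          exact absurd ((hx i).2 (Finset.mem_insert_self i A))
            (not_lt.2 (h2.trans (min_le_left _ _)))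
        · rintro ⟨hx, hx'⟩ j
          refine ⟨(hx j).1, fun hj => ?_⟩
          rcases Finset.mem_insert.1 hj with rfl | hj
          · by_contra hlt
            refine hx' fun l => ⟨?_, (hx l).2⟩
            rcases eq_or_ne l j with rfl | hl
            · rw [Function.update_self]
              exact le_min (not_lt.1 hlt) (hx l).1
            · rw [Function.update_of_ne hl]
              exact (hx l).1
          · exact (hx j).2 hj
      have h2 : ∀ ρ : ProbabilityMeasure (Fin k → ℝ),
          (ρ : Measure (Fin k → ℝ)).real (box (insert i A) a b) =
          (ρ : Measure (Fin k → ℝ)).real (box A a b) - (ρ : Measure (Fin k → ℝ)).real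
            (box A a (Function.update b i (min (a i) (b i)))) := fun ρ => by
        rw [heq, measureReal_sdiff hsub (hmeas _ _ _)]
      simp only [h2]
      exact (ih b hb).sub (ih _ h1)
  have hpi : IsPiSystem {s : Set (Fin k → ℝ) | ∃ a b : Fin k → ℝ, (∀ j, a j ≠ 0) ∧
      (∀ j, b j ≠ 0) ∧ s = box Finset.univ a b} := by
    rintro _ ⟨a, b, ha, hb, rfl⟩ _ ⟨a', b', ha', hb', rfl⟩ -
    refine ⟨fun j => max (a j) (a' j), fun j => min (b j) (b' j), fun j => ?_, fun j => ?_, ?_⟩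
    · rcases max_choice (a j) (a' j) with h | h <;> simp only [h]
      exacts [ha j, ha' j]
    · rcases min_choice (b j) (b' j) with h | h <;> simp only [h]
      exacts [hb j, hb' j]
    · ext x
      simp only [box, Set.mem_inter_iff, Set.mem_ofPred_eq, Finset.mem_univ, forall_const,
        le_min_iff, max_lt_iff, ← forall_and]
      exact forall_congr' fun j => by tauto
  refine hpi.tendsto_probabilityMeasure_of_tendsto_of_mem ?_ ?_ ?_
  · rintro _ ⟨a, b, -, -, rfl⟩
    exact hmeas _ _ _
  · intro u hu x hx
    obtain ⟨ε, hε, hball⟩ := Metric.isOpen_iff.1 hu x hx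
    -- Endpoints can avoid 0, so the admissible boxes still give arbitrarily small neighbourhoods of
    -- every point.
    have hne : ∀ l r : ℝ, l < r → ∃ t, l < t ∧ t < r ∧ t ≠ 0 := fun l r hlr => by
      by_cases h0 : (l + r) / 2 = 0
      · exact ⟨r / 2, by linarith, by linarith, by linarith⟩
      · exact ⟨(l + r) / 2, by linarith, by linarith, h0⟩
    choose a ha1 ha2 ha3 using fun j => hne (x j - ε) (x j) (by linarith)
    choose b hb1 hb2 hb3 using fun j => hne (x j) (x j + ε) (by linarith)
    refine ⟨box Finset.univ a b, ⟨a, b, ha3, hb3, rfl⟩, ?_, ?_⟩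
    · refine Filter.mem_of_superset (set_pi_mem_nhds Set.finite_univ
        fun j _ => Ioo_mem_nhds (ha2 j) (hb1 j)) fun z hz j => ?_
      exact ⟨(hz j trivial).2.le, fun _ => (hz j trivial).1⟩
    · refine subset_trans (fun z hz => ?_) hball
      rw [Metric.mem_ball, dist_pi_lt_iff hε]
      intro j
      have h1 := (hz j).1
      have h2 := (hz j).2 (Finset.mem_univ j)
      rw [Real.dist_eq, abs_lt]
      constructor <;> linarith [ha1 j, hb2 j]
  · rintro _ ⟨a, b, ha, hb, rfl⟩
    simpa using hbox Finset.univ a b ha hb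

/-! ### Convergence of the hikes -/

variable {Ω : Type*} [MeasurableSpace Ω] {P : Measure Ω} [IsProbabilityMeasure P] {ξ : ℕ → Ω → ℝ}

lemma normalizedHikes_apply (k n : ℕ) (w : YF n) (j : Fin k) :
    normalizedHikes k n w j = normHike w.1 j := by
  rw [normalizedHikes, normHike, w.2]

open Classical in
-- Normalized hikes lie in `[0,1]`, so thresholds above 1 may be replaced by 1, and a negative
-- threshold makes both sides 0.
lemma tendsto_measureReal_normalizedHikes (hσ : 1 ≤ σ) (hx : x₁ = 1 ∨ x₁ = σ)
    (hξ : IsXiSequence σ P ξ) (k : ℕ) (b : ℕ → ℝ) (hb : ∀ i < k, b i ≠ 0) :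
    Tendsto (fun n => (cloneMeasure (plancherelX σ x₁) (plancherelY σ) n).real
      {w | ∀ i < k, normHike w.1 i ≤ b i}) atTop
      (𝓝 (P.real {ω | ∀ i < k, ξ i ω ≤ b i})) := by
  obtain ⟨e, hW⟩ := exists_isPlancherelWeight hσ hx
  have h1 : ∀ n, (cloneMeasure (plancherelX σ x₁) (plancherelY σ) n).real
      {w | ∀ i < k, normHike w.1 i ≤ b i} =
      wordMean (cloneWeight (plancherelX σ x₁) (plancherelY σ)) n fun w =>
        if ∀ i < k, normHike w i ≤ b i then 1 else 0 := fun n => by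
    rw [Measure.real, cloneMeasure_apply hW.nonneg n fun w => ∀ i < k, normHike w i ≤ b i,
      ENNReal.toReal_ofReal]
    · congr!
    · refine (wordMean_mem_Icc hW hσ (fun w => ?_) n).1
      split_ifs <;> simp
  simp only [h1, hξ.measureReal_forall_le k b]
  split_ifs with h0
  · refine (tendsto_wordMean_normHike hW hσ k (fun i => min (b i) 1) fun i hi =>
      ⟨lt_min (lt_of_le_of_ne (h0 i hi) (hb i hi).symm) one_pos, min_le_right _ _⟩).congr
        fun n => wordMean_congr n fun w _ => ?_
    simp [normHike_le_one]
  · push Not at h0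
    obtain ⟨i, hi, h0⟩ := h0
    refine tendsto_const_nhds.congr fun n => ?_
    refine (wordMean_const hW hσ n 0).symm.trans (wordMean_congr n fun w _ =>
      (if_neg fun h => ?_).symm)
    linarith [h i hi, normHike_nonneg w i]

lemma tendstoInDistribution_normalizedHikes (hσ : 1 ≤ σ) (hx : x₁ = 1 ∨ x₁ = σ)
    [∀ n, IsProbabilityMeasure (cloneMeasure (plancherelX σ x₁) (plancherelY σ) n)]
    (hξ : IsXiSequence σ P ξ) (k : ℕ) :
    TendstoInDistribution (fun n : ℕ => normalizedHikes k n) atTop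
      (fun (ω : Ω) (j : Fin k) => ξ j ω)
      (fun n : ℕ => cloneMeasure (plancherelX σ x₁) (plancherelY σ) n) P := by
  have hm : Measurable fun (ω : Ω) (j : Fin k) => ξ j ω :=
    measurable_pi_lambda _ fun j => hξ.measurable j
  refine ⟨fun n => (measurable_YF _).aemeasurable, hm.aemeasurable, ?_⟩
  refine tendsto_probabilityMeasure_of_forall_le fun b hb => ?_
  have hbm : MeasurableSet {x : Fin k → ℝ | ∀ j, x j ≤ b j} := by
    have : {x : Fin k → ℝ | ∀ j, x j ≤ b j} = Set.Iic b := rfl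
    rw [this]
    exact measurableSet_Iic
  have := tendsto_measureReal_normalizedHikes hσ hx hξ k
    (fun i => if h : i < k then b ⟨i, h⟩ else 1) (fun i hi => by simp [hi, hb])
  simp only [ProbabilityMeasure.coe_mk, map_measureReal_apply hm hbm,
    map_measureReal_apply (measurable_YF _) hbm]
  have h1 : ∀ p : ℕ → ℝ, (∀ i < k, p i ≤ if h : i < k then b ⟨i, h⟩ else 1) ↔
      ∀ j : Fin k, p j ≤ b j := fun p => by
    rw [Fin.forall_iff]
    exact forall₂_congr fun i hi => by simp [hi]
  simp only [h1] at this
  simpa only [Set.preimage_ofPred_eq, normalizedHikes_apply] using this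

lemma stickBreaking_normHike (w : Word) (j : ℕ) :
    stickBreaking (normHike w) j = hTilde w j / weight w := by
  induction j generalizing w with
  | zero => simp [stickBreaking, normHike_zero]
  | succ j ih =>
    have h1 := ih (tailWord w)
    rw [stickBreaking] at h1 ⊢
    rw [Finset.prod_range_succ', normHike_zero]
    simp only [normHike_succ, hTilde_succ]
    rw [mul_right_comm, h1]
    have h2 : (hTilde w 0 : ℝ) + weight (tailWord w) = weight w := by
      exact_mod_cast hTilde_zero_add_weight w
    rcases Nat.eq_zero_or_pos (weight w) with h0 | h0
    · have : weight (tailWord w) = 0 := by have := hTilde_zero_add_weight w; omega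
      simp [h0, this]
    -- When the tail is empty the normalized hike is `0/0 = 0`, in agreement with `h̃_{j+1} = 0`.
    rcases Nat.eq_zero_or_pos (weight (tailWord w)) with h3 | h3
    · have : tailWord w = [] := by
        rcases h : tailWord w with _ | ⟨_ | _, v⟩
        · rfl
        all_goals simp [h] at h3
      simp [this, hTilde_nil]
    · have h0' : (0 : ℝ) < weight w := by exact_mod_cast h0
      have h3' : (0 : ℝ) < weight (tailWord w) := by exact_mod_cast h3
      rw [one_sub_div h0'.ne', ← h2, add_sub_cancel_left]
      rw [← h2] at h0'
      field_simp

lemma stickBreaking_congr {u v : ℕ → ℝ} {j : ℕ} (h : ∀ i ≤ j, u i = v i) :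
    stickBreaking u j = stickBreaking v j := by
  rw [stickBreaking, stickBreaking, h j le_rfl]
  congr 1
  exact Finset.prod_congr rfl fun i hi => by rw [h i (Finset.mem_range.1 hi).le]

lemma tendstoInDistribution_scaledHikes (hσ : 1 ≤ σ) (hx : x₁ = 1 ∨ x₁ = σ)
    [∀ n, IsProbabilityMeasure (cloneMeasure (plancherelX σ x₁) (plancherelY σ) n)]
    (hξ : IsXiSequence σ P ξ) (k : ℕ) :
    TendstoInDistribution (fun n : ℕ => scaledHikes k n) atTop
      (fun (ω : Ω) (j : Fin k) => stickBreaking (fun i => ξ i ω) j)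
      (fun n : ℕ => cloneMeasure (plancherelX σ x₁) (plancherelY σ) n) P := by
  let ext (u : Fin k → ℝ) (i : ℕ) : ℝ := if h : i < k then u ⟨i, h⟩ else 0
  let g (u : Fin k → ℝ) (j : Fin k) : ℝ := stickBreaking (ext u) j
  have hext : ∀ i, Continuous fun u => ext u i := fun i => by
    by_cases h : i < k
    · simpa [ext, h] using continuous_apply (⟨i, h⟩ : Fin k)
    · simpa [ext, h] using continuous_const
  have hg : Continuous g := continuous_pi fun j =>
    (continuous_finsetProd _ fun i _ => continuous_const.sub (hext i)).mul (hext j)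
  have key : ∀ (p : ℕ → ℝ) (j : Fin k), g (fun i => p i) j = stickBreaking p j := fun p j =>
    stickBreaking_congr fun i hi => by simp [ext, hi.trans_lt j.2]
  have h1 : (fun n : ℕ => scaledHikes k n) = fun n => g ∘ normalizedHikes k n := by
    ext n w j
    have h2 : normalizedHikes k n w = fun i : Fin k => normHike w.1 i :=
      funext fun i => normalizedHikes_apply k n w i
    rw [Function.comp_apply, h2, key, stickBreaking_normHike, scaledHikes, w.2]
  have h2 : (fun (ω : Ω) (j : Fin k) => stickBreaking (fun i => ξ i ω) j) =
      g ∘ fun (ω : Ω) (j : Fin k) => ξ j ω := by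
    ext ω j
    exact (key (fun i => ξ i ω) j).symm
  rw [h1, h2]
  exact (tendstoInDistribution_normalizedHikes hσ hx hξ k).continuous_comp hg

end

end YoungFib
theorem mainTheorem3 (σ : ℝ) (hσ : 1 ≤ σ) (x₁ : ℝ) (hx₁ : x₁ = 1 ∨ x₁ = σ) :
    -- the clone coherent measures `M_n` are probability measures
    (∀ w : Word, 0 ≤ cloneWeight (plancherelX σ x₁) (plancherelY σ) w) ∧
    ∃ _hM : ∀ n : ℕ, IsProbabilityMeasure (cloneMeasure (plancherelX σ x₁) (plancherelY σ) n),
    -- the joint cdfs determine one and only one distribution of a sequence `ξ`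
    (∃! μ : Measure (ℕ → ℝ), IsProbabilityMeasure μ ∧ IsXiSequence σ μ (fun k u => u k)) ∧
    -- the scaling limit of the normalized hikes, and its stick-breaking form
    (∀ (Ω : Type*) [MeasurableSpace Ω] (P : Measure Ω) [IsProbabilityMeasure P]
        (ξ : ℕ → Ω → ℝ), IsXiSequence σ P ξ → ∀ k : ℕ,
      TendstoInDistribution (fun n : ℕ => normalizedHikes k n) atTop
        (fun (ω : Ω) (j : Fin k) => ξ j ω)
        (fun n : ℕ => cloneMeasure (plancherelX σ x₁) (plancherelY σ) n) P ∧
      TendstoInDistribution (fun n : ℕ => scaledHikes k n) atTop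
        (fun (ω : Ω) (j : Fin k) => stickBreaking (fun i => ξ i ω) j)
        (fun n : ℕ => cloneMeasure (plancherelX σ x₁) (plancherelY σ) n) P) ∧
    -- the construction of `ξ` from coins and beta random variables
    (∀ (Ω : Type*) [MeasurableSpace Ω] (P : Measure Ω) [IsProbabilityMeasure P]
        (c : ℕ → Ω → Bool) (U : ℕ → Ω → ℝ), IsCoinSequence σ P c → IsIIDBeta (σ / 2) P U →
        IndepFun (fun ω k => c k ω) (fun ω k => U k ω) P →
      IsXiSequence σ P (fun k ω => truncateAt (successes fun j => c j ω) (fun i => U i ω) k)) ∧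
    -- the `ξ`'s are dependent for `σ > 1`
    (1 < σ → ∀ (Ω : Type*) [MeasurableSpace Ω] (P : Measure Ω) [IsProbabilityMeasure P]
        (ξ : ℕ → Ω → ℝ), IsXiSequence σ P ξ → ¬ iIndepFun ξ P) ∧
    -- at `σ = 1` the limit is the stick-breaking of i.i.d. `beta(1, 1/2)`, that is, `GEM(1/2)`
    (σ = 1 → ∀ (Ω : Type*) [MeasurableSpace Ω] (P : Measure Ω) [IsProbabilityMeasure P]
        (U : ℕ → Ω → ℝ), IsIIDBeta (1 / 2) P U → IsXiSequence σ P U ∧ ∀ k : ℕ,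
      TendstoInDistribution (fun n : ℕ => scaledHikes k n) atTop
        (fun (ω : Ω) (j : Fin k) => stickBreaking (fun i => U i ω) j)
        (fun n : ℕ => cloneMeasure (plancherelX σ x₁) (plancherelY σ) n) P) := by
  refine ⟨cloneWeight_nonneg hσ hx₁, isProbabilityMeasure_cloneMeasure hσ hx₁,
    existsUnique_isXiSequence hσ, ?_, ?_, ?_, ?_⟩
  · intro Ω _ P _ ξ hξ k
    have := isProbabilityMeasure_cloneMeasure hσ hx₁
    exact ⟨tendstoInDistribution_normalizedHikes hσ hx₁ hξ k,
      tendstoInDistribution_scaledHikes hσ hx₁ hξ k⟩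
  · intro Ω _ P _ c U hc hU hind
    exact isXiSequence_truncateAt (by linarith) hc hU hind
  · intro hσ' Ω _ P _ ξ hξ
    exact hξ.not_iIndepFun hσ'
  · intro hσ' Ω _ P _ U hU
    have hξ : IsXiSequence σ P U := hσ' ▸ isXiSequence_of_isIIDBeta hU
    have := isProbabilityMeasure_cloneMeasure hσ hx₁
    exact ⟨hξ, tendstoInDistribution_scaledHikes hσ hx₁ hξ⟩
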